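/- Let $M$ be a smooth $m$-manifold with a foliation $\mathcal F$ of codimension $q$, defined by a cocycle $\{U_i,f_i,\gamma_{ij}\}$ modelled on a smooth $q$-manifold $N$: the $U_i$ form an open covering of $M$, the $f_i:U_i\to N$ are smooth submersions with connected fibres, and the $\gamma_{ij}$ are local diffeomorphisms of $N$ with $f_i=\gamma_{ij}\circ f_j$ on $U_i\cap U_j$. Let $g$ and $g_0$ be smooth Riemannian metrics on $M$ and $N$ for which $\mathcal F$ is Riemannian, i.e. the $f_i$ are Riemannian submersions and the $\gamma_{ij}$ are local isometries. Let $N(M,\mathcal F)=TM/T\mathcal F$ be the normal bundle, identified with $T\mathcal F^{\perp}$ by means of $g$ and carrying the induced metric. Let $\nabla$ be its foliated Levi-Civita connection (the pullback under the $f_i$ of the Levi-Civita connection of $(N,g_0)$), let $R$ and $\mathrm{Ric}$ be its (transverse) curvature and Ricci tensors, with the conventions $R(X,Y)=[\nabla_X,\nabla_Y]-\nabla_{[X,Y]}$, $R(X,Y,Z,W)=\langle R(X,Y)W,Z\rangle$ and $\mathrm{Ric}(X,Y)=\sum_i R(e_i,X,e_i,Y)$ for an orthonormal frame $(e_i)$.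 A normal tensor field of rank $p$ is a smooth section $U$ of $\bigotimes^p N(M,\mathcal F)^*$ (not necessarily constant along the leaves). Its basic Laplacian is the normal tensor field of rank $p$ given, in a local orthonormal frame $(e_A)_{A=1,\dots,q}$ of the normal bundle and with $R_{ab,cd}=R(e_a,e_b,e_c,e_d)$, by $$(\Delta_b U)_{\alpha_1\dots\alpha_p}=-\nabla^i\nabla_i U_{\alpha_1\dots\alpha_p}+\sum_{j}\sum_{A}\mathrm{Ric}_{\alpha_jA}\,U_{\alpha_1\dots A\dots\alpha_p}-\sum_{j\ne k}\sum_{A,B}R_{\alpha_jA,\alpha_kB}\,U_{\alpha_1\dots A\dots B\dots\alpha_p},$$ where $A$ stands in the $j$-th and $B$ in the $k$-th place, the last sum is over ordered pairs $(j,k)$, and $\nabla^i\nabla_i=\sum_{i=1}^q(\nabla_{e_i}\nabla_{e_i}-\nabla_{\nabla_{e_i}e_i})$. **Theorem.** Let $T$ be a normal tensor field of rank $p\ge 0$ with $\nabla T=0$ (that is, $\nabla_vT=0$ for every $v\in TM$). Then for every normal tensor field $U$ of any rank $r\ge 0$, $$\Delta_b(T\otimes U)=T\otimes\Delta_b U .$$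 -/

import Mathlib

open Set Bundle
open scoped Manifold ContDiff Topology

noncomputable section

/-- The coordinate space `ℝ^q`. -/
abbrev Coord (q : ℕ) : Type := EuclideanSpace ℝ (Fin q)

/-- A smooth Riemannian metric on the tangent bundle of an `n`-manifold `X`. -/
abbrev TangentMetric (n : ℕ) (X : Type*) [TopologicalSpace X] [ChartedSpace (Coord n) X]
    [IsManifold (𝓡 n) ∞ X] :=
  ContMDiffRiemannianMetric (𝓡 n) ∞ (Coord n) (fun x : X => TangentSpace (𝓡 n) x)

/-! ### Levi-Civita calculus of a Riemannian `q`-manifold in a chart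

`y₀ : N` selects the chart `extChartAt (𝓡 q) y₀`; `z` is a point of its target in `ℝ^q`. -/

section Riemannian

variable {q : ℕ} {N : Type*} [TopologicalSpace N] [ChartedSpace (Coord q) N]
  [IsManifold (𝓡 q) ∞ N]

/-- The partial derivative `∂_a u (z)`. -/
def partialDeriv (a : Fin q) (u : Coord q → ℝ) (z : Coord q) : ℝ :=
  fderiv ℝ u z (EuclideanSpace.single a 1)

/-- The metric coefficients `g_{ab} = g(∂_a, ∂_b)`. -/
def metricCoeff (g : TangentMetric q N) (y₀ : N) (z : Coord q) : Matrix (Fin q) (Fin q) ℝ :=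
  Matrix.of fun a b =>
    g.inner ((extChartAt (𝓡 q) y₀).symm z)
      (mfderiv 𝓘(ℝ, Coord q) (𝓡 q) (extChartAt (𝓡 q) y₀).symm z (EuclideanSpace.single a 1))
      (mfderiv 𝓘(ℝ, Coord q) (𝓡 q) (extChartAt (𝓡 q) y₀).symm z (EuclideanSpace.single b 1))

/-- The inverse matrix `g^{ab}` of the metric coefficients. -/
def metricInv (g : TangentMetric q N) (y₀ : N) (z : Coord q) : Matrix (Fin q) (Fin q) ℝ :=
  (metricCoeff g y₀ z)⁻¹

/-- The Christoffel symbols of the Levi-Civita connection: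
`christoffel g y₀ a b d z` is `Γ^d_{ab}`, where `∇_{∂_a} ∂_b = ∑ d, Γ^d_{ab} ∂_d`. -/
def christoffel (g : TangentMetric q N) (y₀ : N) (a b d : Fin q) (z : Coord q) : ℝ :=
  (1 / 2) * ∑ k, metricInv g y₀ z d k *
    (partialDeriv a (fun w => metricCoeff g y₀ w b k) z
      + partialDeriv b (fun w => metricCoeff g y₀ w a k) z
      - partialDeriv k (fun w => metricCoeff g y₀ w a b) z)

/-- The coefficients of the curvature operator
`R(X, Y) = ∇_X ∇_Y - ∇_Y ∇_X - ∇_{[X, Y]}`: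
`R(∂_a, ∂_b) ∂_c = ∑ d, curvCoeff g y₀ a b c d • ∂_d`. -/
def curvCoeff (g : TangentMetric q N) (y₀ : N) (a b c d : Fin q) (z : Coord q) : ℝ :=
  partialDeriv a (christoffel g y₀ b c d) z - partialDeriv b (christoffel g y₀ a c d) z
    + ∑ e, (christoffel g y₀ a e d z * christoffel g y₀ b c e z
      - christoffel g y₀ b e d z * christoffel g y₀ a c e z)

/-- The Riemann tensor `R_{ab,cd} = g(R(∂_a, ∂_b) ∂_d, ∂_c)`. -/
def riemann (g : TangentMetric q N) (y₀ : N) (a b c d : Fin q) (z : Coord q) : ℝ :=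
  ∑ e, curvCoeff g y₀ a b d e z * metricCoeff g y₀ z e c

/-- The Ricci tensor `Ric_{ab}`, the trace of `Z ↦ R(Z, ∂_a) ∂_b`. -/
def ricci (g : TangentMetric q N) (y₀ : N) (a b : Fin q) (z : Coord q) : ℝ :=
  ∑ c, curvCoeff g y₀ c a b c z

end Riemannian

/-! ### Foliations -/

/-- The derivative `v(u)` of the function `u` in the direction `v ∈ T_x M`. -/
def dirDeriv {m : ℕ} {M : Type*} [TopologicalSpace M] [ChartedSpace (Coord m) M] (u : M → ℝ)
    (x : M) (v : TangentSpace (𝓡 m) x) : ℝ :=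
  mfderiv (𝓡 m) 𝓘(ℝ, ℝ) u x v

/-- A foliation of codimension `q` of the `m`-manifold `M`, given by a cocycle
`{U_i, f_i, γ_ij}` modelled on the `q`-manifold `N`: the `U_i` are an open covering of `M`, the
`f_i : U_i → N` are smooth submersions with connected fibres, and the `γ_ij` are local
diffeomorphisms of `N` with `f_i = γ_ij ∘ f_j` on `U_i ∩ U_j`. -/
structure Foliation (m q : ℕ) (M N ι : Type*)
    [TopologicalSpace M] [ChartedSpace (Coord m) M]
    [TopologicalSpace N] [ChartedSpace (Coord q) N] where
  U : ι → Set M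
  isOpen_U : ∀ i, IsOpen (U i)
  exists_mem : ∀ x, ∃ i, x ∈ U i
  f : ι → M → N
  contMDiffOn_f : ∀ i, ContMDiffOn (𝓡 m) (𝓡 q) ∞ (f i) (U i)
  submersion : ∀ i, ∀ x ∈ U i, Function.Surjective (mfderiv (𝓡 m) (𝓡 q) (f i) x)
  isPreconnected_fibre : ∀ i y, IsPreconnected (U i ∩ f i ⁻¹' {y})
  γ : ι → ι → OpenPartialHomeomorph N N
  contMDiffOn_γ : ∀ i j, ContMDiffOn (𝓡 q) (𝓡 q) ∞ (γ i j) (γ i j).source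
  contMDiffOn_γ_symm : ∀ i j, ContMDiffOn (𝓡 q) (𝓡 q) ∞ (γ i j).symm (γ i j).target
  mem_source : ∀ i j, ∀ x ∈ U i ∩ U j, f j x ∈ (γ i j).source
  f_eq : ∀ i j, ∀ x ∈ U i ∩ U j, f i x = γ i j (f j x)

namespace Foliation

variable {m q : ℕ} {M N ι : Type*}
  [TopologicalSpace M] [ChartedSpace (Coord m) M]
  [TopologicalSpace N] [ChartedSpace (Coord q) N]

/-- The tangent space `T_x F` of the leaf through `x`: the common kernel of the differentials at
`x` of the local submersions defined at `x` (all of these kernels coincide). -/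
def leafTangent (F : Foliation m q M N ι) (x : M) : Submodule ℝ (TangentSpace (𝓡 m) x) :=
  ⨅ (i : ι) (_ : x ∈ F.U i), LinearMap.ker (mfderiv (𝓡 m) (𝓡 q) (F.f i) x).toLinearMap

/-- The fibre at `x` of the normal bundle `TM / TF`. -/
abbrev Normal (F : Foliation m q M N ι) (x : M) : Type :=
  TangentSpace (𝓡 m) x ⧸ F.leafTangent x

lemma leafTangent_le (F : Foliation m q M N ι) {x : M} {i : ι} (hx : x ∈ F.U i) :
    F.leafTangent x ≤ LinearMap.ker (mfderiv (𝓡 m) (𝓡 q) (F.f i) x).toLinearMap :=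
  iInf₂_le i hx

/-- The identification `Normal x → T_{f_i(x)} N` induced by the differential of `f_i`. -/
def normalDeriv (F : Foliation m q M N ι) {x : M} {i : ι} (hx : x ∈ F.U i) :
    F.Normal x →ₗ[ℝ] TangentSpace (𝓡 q) (F.f i x) :=
  (F.leafTangent x).liftQ (mfderiv (𝓡 m) (𝓡 q) (F.f i) x).toLinearMap (F.leafTangent_le hx)

/-- A (not necessarily smooth) normal tensor field of rank `p`: a section of the `p`-th tensor
power of the dual of the normal bundle. -/
abbrev NormalTensor (F : Foliation m q M N ι) (p : ℕ) : Type _ :=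
  ∀ x : M, MultilinearMap ℝ (fun _ : Fin p => F.Normal x) ℝ

/-- A normal tensor field is smooth if its values on (the classes of) arbitrary local smooth
vector fields are smooth. -/
def NormalTensor.IsSmooth {F : Foliation m q M N ι} [IsManifold (𝓡 m) ∞ M] {p : ℕ}
    (T : F.NormalTensor p) : Prop :=
  ∀ (O : Set M), IsOpen O → ∀ X : Fin p → ∀ x : M, TangentSpace (𝓡 m) x,
    (∀ j, ContMDiffOn (𝓡 m) (𝓡 m).tangent ∞
      (fun x => (⟨x, X j x⟩ : TangentBundle (𝓡 m) M)) O) →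
    ContMDiffOn (𝓡 m) 𝓘(ℝ, ℝ) ∞
      (fun x => T x fun j => (F.leafTangent x).mkQ (X j x)) O

/-- The tensor product `(T ⊗ U)(w) = T(w_1, …, w_p) U(w_{p+1}, …, w_{p+r})`. -/
def NormalTensor.tensor {F : Foliation m q M N ι} {p r : ℕ}
    (T : F.NormalTensor p) (U : F.NormalTensor r) : F.NormalTensor (p + r) := fun x =>
  ((LinearMap.mul' ℝ ℝ).compMultilinearMap ((T x).domCoprod (U x))).domDomCongr finSumFinEquiv

/-- The transverse coordinates `f_i` followed by the chart of `N` at `y₀`. -/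
def coord (F : Foliation m q M N ι) (i : ι) (y₀ : N) (x : M) : Coord q :=
  extChartAt (𝓡 q) y₀ (F.f i x)

/-- The `a`-th transverse coordinate of a vector `v ∈ T_x M`, i.e. `v^a` in `[v] = ∑ a, v^a [∂_a]`.
-/
def coordDeriv (F : Foliation m q M N ι) (i : ι) (y₀ : N) (a : Fin q) (x : M)
    (v : TangentSpace (𝓡 m) x) : ℝ :=
  (EuclideanSpace.proj a : Coord q →L[ℝ] ℝ)
    (mfderiv (𝓡 m) 𝓘(ℝ, Coord q) (F.coord i y₀) x v)

/-- The open set on which the transverse coordinates `F.coord i y₀` are defined. -/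
def coordDomain (F : Foliation m q M N ι) (i : ι) (y₀ : N) : Set M :=
  F.U i ∩ F.f i ⁻¹' (extChartAt (𝓡 q) y₀).source

/-- The components of a normal vector in the transverse coordinates: `w = ∑ a, w^a ∂_a`. -/
def normalCoord (F : Foliation m q M N ι) {i : ι} (y₀ : N) {x : M} (hx : x ∈ F.U i)
    (a : Fin q) : F.Normal x →ₗ[ℝ] ℝ :=
  (EuclideanSpace.proj a : Coord q →L[ℝ] ℝ).toLinearMap ∘ₗ
    (mfderiv (𝓡 q) 𝓘(ℝ, Coord q) (extChartAt (𝓡 q) y₀) (F.f i x)).toLinearMap ∘ₗ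
      F.normalDeriv hx

variable [IsManifold (𝓡 m) ∞ M] [IsManifold (𝓡 q) ∞ N]

/-- The foliation is Riemannian for the metrics `g` on `M` and `g₀` on `N` (that is, `g` is
bundle-like with transverse metric `g₀`): the `f_i` are Riemannian submersions and the `γ_ij` are
local isometries. -/
structure IsRiemannian (F : Foliation m q M N ι) (g : TangentMetric m M)
    (g₀ : TangentMetric q N) : Prop where
  submersion : ∀ i, ∀ x ∈ F.U i, ∀ v w : TangentSpace (𝓡 m) x,
    (∀ u ∈ F.leafTangent x, g.inner x v u = 0) → (∀ u ∈ F.leafTangent x, g.inner x w u = 0) →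
    g₀.inner (F.f i x) (mfderiv (𝓡 m) (𝓡 q) (F.f i) x v) (mfderiv (𝓡 m) (𝓡 q) (F.f i) x w)
      = g.inner x v w
  isometry : ∀ i j, ∀ y ∈ (F.γ i j).source, ∀ v w : TangentSpace (𝓡 q) y,
    g₀.inner (F.γ i j y) (mfderiv (𝓡 q) (𝓡 q) (F.γ i j) y v) (mfderiv (𝓡 q) (𝓡 q) (F.γ i j) y w)
      = g₀.inner y v w

/-- The local frame `e_a` of the orthogonal complement of `TF`: `e_a(x)` is the unique vector
orthogonal to `T_x F` that projects to the coordinate vector `∂_a`. -/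
def horizFrame (F : Foliation m q M N ι) (g : TangentMetric m M) (i : ι) (y₀ : N) (a : Fin q)
    (x : M) : TangentSpace (𝓡 m) x :=
  Classical.epsilon fun v : TangentSpace (𝓡 m) x =>
    (∀ u ∈ F.leafTangent x, g.inner x v u = 0) ∧
      mfderiv (𝓡 m) 𝓘(ℝ, Coord q) (F.coord i y₀) x v = EuclideanSpace.single a (1 : ℝ)

/-- The component `T_{c_1 … c_p} = T([e_{c_1}], …, [e_{c_p}])`. -/
def comp (F : Foliation m q M N ι) (g : TangentMetric m M) (i : ι) (y₀ : N) {p : ℕ}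
    (T : F.NormalTensor p) (c : Fin p → Fin q) (x : M) : ℝ :=
  T x fun j => (F.leafTangent x).mkQ (F.horizFrame g i y₀ (c j) x)

/-- The component `(∇_v T)_{c_1 … c_p}` at `x`, `v ∈ T_x M`, of the covariant derivative of `T`
for the foliated Levi-Civita connection of the normal bundle, i.e. the pullback by `f_i` of the
Levi-Civita connection of `(N, g₀)`: `∇_v [e_b] = ∑ a d, v^a Γ^d_{ab} [e_d]`, where `v^a` are the
components of the class of `v`. -/
def covDeriv (F : Foliation m q M N ι) (g : TangentMetric m M) (g₀ : TangentMetric q N) (i : ι)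
    (y₀ : N) {p : ℕ} (T : F.NormalTensor p) (c : Fin p → Fin q) (x : M)
    (v : TangentSpace (𝓡 m) x) : ℝ :=
  dirDeriv (F.comp g i y₀ T c) x v
    - ∑ j, ∑ a, ∑ d,
      F.coordDeriv i y₀ a x v
        * christoffel g₀ y₀ a (c j) d (F.coord i y₀ x)
        * F.comp g i y₀ T (Function.update c j d) x

/-- The component `(∇_{e_a} ∇_{e_b} T - ∇_{∇_{e_a} e_b} T)_{c_1 … c_p}` at `x` of the second
covariant derivative of `T`. -/
def covDeriv₂ (F : Foliation m q M N ι) (g : TangentMetric m M) (g₀ : TangentMetric q N) (i : ι)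
    (y₀ : N) {p : ℕ} (T : F.NormalTensor p) (a b : Fin q) (c : Fin p → Fin q) (x : M) : ℝ :=
  dirDeriv (fun z => F.covDeriv g g₀ i y₀ T c z (F.horizFrame g i y₀ b z)) x
      (F.horizFrame g i y₀ a x)
    - ∑ j, ∑ d, christoffel g₀ y₀ a (c j) d (F.coord i y₀ x)
        * F.covDeriv g g₀ i y₀ T (Function.update c j d) x (F.horizFrame g i y₀ b x)
    - ∑ d, christoffel g₀ y₀ a b d (F.coord i y₀ x)
        * F.covDeriv g g₀ i y₀ T c x (F.horizFrame g i y₀ d x)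

/-- The covariant derivative of the normal tensor field `T` vanishes (in all directions of `TM`).
-/
def IsParallel (F : Foliation m q M N ι) (g : TangentMetric m M) (g₀ : TangentMetric q N)
    {p : ℕ} (T : F.NormalTensor p) : Prop :=
  ∀ (i : ι) (y₀ : N), ∀ x ∈ F.coordDomain i y₀, ∀ (v : TangentSpace (𝓡 m) x)
    (c : Fin p → Fin q), F.covDeriv g g₀ i y₀ T c x v = 0

/-- The component of the basic Laplacian of the normal tensor field `T` in transverse coordinates,
`- ∇^a ∇_a T_{c_1 … c_p} + ∑ j, Ric_{c_j}^A T_{… A …}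
  - ∑ j ≠ k, R_{c_j}^A_{c_k}^B T_{… A … B …}`
with `A` in the `j`-th place and `B` in the `k`-th place. -/
def laplacianComp (F : Foliation m q M N ι) (g : TangentMetric m M) (g₀ : TangentMetric q N)
    (i : ι) (y₀ : N) {p : ℕ} (T : F.NormalTensor p) (c : Fin p → Fin q) (x : M) : ℝ :=
  - ∑ a, ∑ b, metricInv g₀ y₀ (F.coord i y₀ x) a b * F.covDeriv₂ g g₀ i y₀ T a b c x
    + ∑ j, ∑ A, ∑ A', ricci g₀ y₀ (c j) A (F.coord i y₀ x)
        * metricInv g₀ y₀ (F.coord i y₀ x) A A'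
        * F.comp g i y₀ T (Function.update c j A') x
    - ∑ j, ∑ k ∈ Finset.univ.erase j, ∑ A, ∑ A', ∑ B, ∑ B',
        riemann g₀ y₀ (c j) A (c k) B (F.coord i y₀ x)
        * metricInv g₀ y₀ (F.coord i y₀ x) A A' * metricInv g₀ y₀ (F.coord i y₀ x) B B'
        * F.comp g i y₀ T (Function.update (Function.update c j A') k B') x

/-- The normal tensor at `x ∈ U_i` whose components in the transverse coordinates `F.coord i y₀`
are those of the basic Laplacian of `T`. -/
def laplacianIn (F : Foliation m q M N ι) (g : TangentMetric m M) (g₀ : TangentMetric q N)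
    {i : ι} (y₀ : N) {p : ℕ} (T : F.NormalTensor p) {x : M} (hx : x ∈ F.U i) :
    MultilinearMap ℝ (fun _ : Fin p => F.Normal x) ℝ :=
  ∑ c : Fin p → Fin q, F.laplacianComp g g₀ i y₀ T c x •
    (MultilinearMap.mkPiAlgebra ℝ (Fin p) ℝ).compLinearMap
      fun j => F.normalCoord y₀ hx (c j)

/-- The basic Laplacian `Δ_b T` of a normal tensor field. At `x` it is computed in the transverse
coordinates given by some `f_i` defined at `x` and the chart of `N` at `f_i(x)`; being a
coordinate expression of a tensor, the value does not depend on these coordinates. -/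
def basicLaplacian (F : Foliation m q M N ι) (g : TangentMetric m M) (g₀ : TangentMetric q N)
    {p : ℕ} (T : F.NormalTensor p) : F.NormalTensor p := fun x =>
  F.laplacianIn g g₀ (F.f (F.exists_mem x).choose x) T (F.exists_mem x).choose_spec

end Foliation

end

/-!
In transverse coordinates a parallel `T` satisfies `dT = ∑ a, du^a • (Γ_a · T)`, where matrices act
on tensors as derivations. Since `d(dT) = 0`, the curvature matrices annihilate `T`. The same
argument applied to the metric gives the antisymmetry of `riemann` in its last two indices, hence
its pair symmetry.

The Ricci and curvature terms of `Δ_b` together form minus the second-order operator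
`∑ E_{ab} · (Ω_{ab} · t)`, where `E_{ab}` are the elementary matrices and each `Ω_{ab}` is a
combination of curvature matrices. On `T ⊗ U` all `Ω_{ab}` act on `U` alone. What remains is
`T ⊗ ∑ E_{ab} · (Ω_{ab} · U)` and the cross term `∑ (E_{ab} · T) ⊗ (Ω_{ab} · U)`, and by pair
symmetry the latter equals `∑ (Ω_{ab} · T) ⊗ (E_{ab} · U) = 0`. The rough Laplacian passes through
`T` by the Leibniz rule.
-/

noncomputable section

section TensorAction

variable {R κ ι : Type*} [CommRing R] [Fintype κ] [Fintype ι] [DecidableEq ι]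

/-- The action of a matrix, by derivations, on tensors with slots `ι`; tensors are given by their
components `t : (ι → κ) → R`. -/
def tensorAction : Matrix κ κ R →ₗ[R] ((ι → κ) → R) →ₗ[R] ((ι → κ) → R) :=
  LinearMap.mk₂ R (fun A t c => ∑ j, ∑ d, A (c j) d * t (Function.update c j d))
    (fun A B t => funext fun c => by simp [add_mul, Finset.sum_add_distrib])
    (fun r A t => funext fun c => by simp [mul_assoc, Finset.mul_sum])
    (fun A t u => funext fun c => by simp [mul_add, Finset.sum_add_distrib])
    (fun r A t => funext fun c => by simp [mul_left_comm, Finset.mul_sum])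

lemma tensorAction_apply (A : Matrix κ κ R) (t : (ι → κ) → R) (c : ι → κ) :
    tensorAction A t c = ∑ j, ∑ d, A (c j) d * t (Function.update c j d) :=
  rfl

/-- The action on tensors of an element `Ω` of `𝔤𝔩 ⊗ 𝔤𝔩`, both factors acting one after the other by
derivations; `Ω a b` is the matrix obtained from the `(a, b)` entry of the first factor. -/
def casimirAction (Ω : κ → κ → Matrix κ κ R) (t : (ι → κ) → R) (c : ι → κ) : R :=
  ∑ j, ∑ d, tensorAction (Ω (c j) d) t (Function.update c j d)

/-- The part of `casimirAction Ω` in which the two factors of `Ω` act in different slots. -/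
def pairAction (Ω : κ → κ → Matrix κ κ R) (t : (ι → κ) → R) (c : ι → κ) : R :=
  ∑ j, ∑ k ∈ Finset.univ.erase j, ∑ d, ∑ e,
    Ω (c j) d (c k) e * t (Function.update (Function.update c j d) k e)

lemma casimirAction_eq_add_pairAction (Ω : κ → κ → Matrix κ κ R) (t : (ι → κ) → R) :
    casimirAction Ω t
      = tensorAction (Matrix.of fun x e => ∑ d, Ω x d d e) t + pairAction Ω t := by
  have split_slot : ∀ (c : ι → κ) (j : ι) (d : κ),
      tensorAction (Ω (c j) d) t (Function.update c j d)
        = ∑ e, Ω (c j) d d e * t (Function.update c j e)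
          + ∑ k ∈ Finset.univ.erase j, ∑ e,
              Ω (c j) d (c k) e * t (Function.update (Function.update c j d) k e) := by
    intro c j d
    rw [tensorAction_apply, ← Finset.add_sum_erase _ _ (Finset.mem_univ j)]
    congr 1
    · simp
    · refine Finset.sum_congr rfl fun k hk => ?_
      rw [Function.update_of_ne (Finset.ne_of_mem_erase hk)]
  funext c
  simp only [casimirAction, split_slot, Finset.sum_add_distrib, Pi.add_apply, tensorAction_apply,
    Matrix.of_apply, Finset.sum_mul, pairAction]
  congr 1 <;> exact Finset.sum_congr rfl fun j _ => Finset.sum_comm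

lemma pairAction_comm {Ω Ω' : κ → κ → Matrix κ κ R} (h : ∀ a b c d, Ω a b c d = Ω' c d a b)
    (t : (ι → κ) → R) : pairAction Ω t = pairAction Ω' t := by
  funext c
  unfold pairAction
  rw [Finset.sum_comm' (t' := Finset.univ) (s' := fun k => Finset.univ.erase k)
    (by simp [eq_comm])]
  refine Finset.sum_congr rfl fun j _ => Finset.sum_congr rfl fun k hk => ?_
  rw [Finset.sum_comm]
  simp only [h, Function.update_comm (Finset.ne_of_mem_erase hk)]

lemma tensorAction_tensorAction (A B : Matrix κ κ R) (t : (ι → κ) → R) :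
    tensorAction A (tensorAction B t)
      = tensorAction (A * B) t + pairAction (fun a b => A a b • B) t := by
  have h : tensorAction A (tensorAction B t) = casimirAction (fun a b => A a b • B) t := by
    funext c
    simp only [tensorAction_apply A, casimirAction, map_smul, LinearMap.smul_apply, Pi.smul_apply,
      smul_eq_mul]
  rw [h, casimirAction_eq_add_pairAction]
  rfl

lemma tensorAction_lie (A B : Matrix κ κ R) (t : (ι → κ) → R) :
    tensorAction ⁅A, B⁆ t
      = tensorAction A (tensorAction B t) - tensorAction B (tensorAction A t) := by
  rw [tensorAction_tensorAction, tensorAction_tensorAction,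
    pairAction_comm (Ω := fun a b => A a b • B) (Ω' := fun a b => B a b • A)
      fun a b c d => mul_comm _ _, Ring.lie_def,
    map_sub, LinearMap.sub_apply, add_sub_add_right_eq_sub]

end TensorAction

section TensorProduct

lemma natAdd_ne_castAdd {p r : ℕ} (j : Fin p) (k : Fin r) : Fin.natAdd p k ≠ Fin.castAdd r j := by
  rw [ne_eq, Fin.ext_iff, Fin.val_natAdd, Fin.val_castAdd]
  omega

lemma update_castAdd_comp_castAdd {α : Type*} {p r : ℕ} (c : Fin (p + r) → α) (j : Fin p) (d : α) :
    Function.update c (Fin.castAdd r j) d ∘ Fin.castAdd r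
      = Function.update (c ∘ Fin.castAdd r) j d :=
  Function.update_comp_eq_of_injective _ (Fin.castAdd_injective p r) _ _

lemma update_castAdd_comp_natAdd {α : Type*} {p r : ℕ} (c : Fin (p + r) → α) (j : Fin p) (d : α) :
    Function.update c (Fin.castAdd r j) d ∘ Fin.natAdd p = c ∘ Fin.natAdd p :=
  Function.update_comp_eq_of_forall_ne _ _ fun k => natAdd_ne_castAdd j k

lemma update_natAdd_comp_natAdd {α : Type*} {p r : ℕ} (c : Fin (p + r) → α) (j : Fin r) (d : α) :
    Function.update c (Fin.natAdd p j) d ∘ Fin.natAdd p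
      = Function.update (c ∘ Fin.natAdd p) j d :=
  Function.update_comp_eq_of_injective _ (Fin.natAdd_injective r p) _ _

lemma update_natAdd_comp_castAdd {α : Type*} {p r : ℕ} (c : Fin (p + r) → α) (j : Fin r) (d : α) :
    Function.update c (Fin.natAdd p j) d ∘ Fin.castAdd r = c ∘ Fin.castAdd r :=
  Function.update_comp_eq_of_forall_ne _ _ fun k => (natAdd_ne_castAdd k j).symm

variable {R κ : Type*} [CommRing R] {p r : ℕ}

/-- The components of the tensor product of two tensors given by their components. -/
def tensorMul (t : (Fin p → κ) → R) (u : (Fin r → κ) → R) (c : Fin (p + r) → κ) : R :=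
  t (c ∘ Fin.castAdd r) * u (c ∘ Fin.natAdd p)

variable [Fintype κ]

lemma tensorAction_tensorMul (A : Matrix κ κ R) (t : (Fin p → κ) → R) (u : (Fin r → κ) → R) :
    tensorAction A (tensorMul t u)
      = tensorMul (tensorAction A t) u + tensorMul t (tensorAction A u) := by
  funext c
  simp only [tensorAction_apply, tensorMul, Pi.add_apply, Fin.sum_univ_add,
    update_castAdd_comp_castAdd, update_castAdd_comp_natAdd, update_natAdd_comp_natAdd,
    update_natAdd_comp_castAdd, Finset.sum_mul, Finset.mul_sum, Function.comp_apply, mul_assoc,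
    mul_left_comm (t _)]

lemma casimirAction_tensorMul {Ω : κ → κ → Matrix κ κ R} (hΩ : ∀ a b c d, Ω a b c d = Ω c d a b)
    {t : (Fin p → κ) → R} (ht : ∀ a b, tensorAction (Ω a b) t = 0) (u : (Fin r → κ) → R) :
    casimirAction Ω (tensorMul t u) = tensorMul t (casimirAction Ω u) := by
  have action_tensorMul : ∀ a b,
      tensorAction (Ω a b) (tensorMul t u) = tensorMul t (tensorAction (Ω a b) u) := by
    intro a b
    rw [tensorAction_tensorMul, ht]
    funext c
    simp [tensorMul]
  have cross_term : ∀ (c₁ : Fin p → κ) (c₂ : Fin r → κ),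
      ∑ j, ∑ d, t (Function.update c₁ j d) * tensorAction (Ω (c₁ j) d) u c₂ = 0 := by
    intro c₁ c₂
    calc ∑ j, ∑ d, t (Function.update c₁ j d) * tensorAction (Ω (c₁ j) d) u c₂
        = ∑ x : Fin p × κ, ∑ y : Fin r × κ, t (Function.update c₁ x.1 x.2)
            * (Ω (c₁ x.1) x.2 (c₂ y.1) y.2 * u (Function.update c₂ y.1 y.2)) := by
          simp only [Fintype.sum_prod_type, tensorAction_apply, Finset.mul_sum]
      _ = ∑ y : Fin r × κ, ∑ x : Fin p × κ, Ω (c₂ y.1) y.2 (c₁ x.1) x.2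
            * t (Function.update c₁ x.1 x.2) * u (Function.update c₂ y.1 y.2) := by
          rw [Finset.sum_comm]
          refine Finset.sum_congr rfl fun y _ => Finset.sum_congr rfl fun x _ => ?_
          rw [hΩ]
          ring
      _ = ∑ k, ∑ e, tensorAction (Ω (c₂ k) e) t c₁ * u (Function.update c₂ k e) := by
          simp only [Fintype.sum_prod_type, tensorAction_apply, Finset.sum_mul]
      _ = 0 := by simp [ht]
  funext c
  simp only [casimirAction, action_tensorMul, tensorMul, Fin.sum_univ_add,
    update_castAdd_comp_castAdd, update_castAdd_comp_natAdd, update_natAdd_comp_natAdd,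
    update_natAdd_comp_castAdd, ← Finset.mul_sum]
  have := cross_term (c ∘ Fin.castAdd r) (c ∘ Fin.natAdd p)
  simp only [Function.comp_apply] at this ⊢
  rw [this, zero_add]

end TensorProduct

section FlatSections

variable {q : ℕ} {E V : Type*} [NormedAddCommGroup E] [NormedSpace ℝ E] [NormedAddCommGroup V]
  [NormedSpace ℝ V]

lemma hasFDerivAt_fderiv_apply {f : E → V} {z : E} (hf : ContDiffAt ℝ 2 f z) (w : E) :
    HasFDerivAt (fun y => fderiv ℝ f y w) ((fderiv ℝ (fderiv ℝ f) z).flip w) z := by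
  have := (hf.fderiv_right (m := 1) (by norm_num)).differentiableAt one_ne_zero
  simpa using this.hasFDerivAt.clm_apply (hasFDerivAt_const w z)

-- Compare `d(df) = 0` with `d(∑ a, η_a du^a) = ∑ a, dη_a ∧ du^a`.
lemma sum_smul_fderiv_comm_of_fderiv_eq {f : E → V} {u : E → Coord q} {η : Fin q → E → V} {z : E}
    (hf : ContDiffAt ℝ 2 f z) (hu : ContDiffAt ℝ 2 u z) (hη : ∀ a, DifferentiableAt ℝ (η a) z)
    (hfη : ∀ᶠ y in 𝓝 z, ∀ v, fderiv ℝ f y v = ∑ a, fderiv ℝ u y v a • η a y) (v w : E) :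
    ∑ a, fderiv ℝ u z w a • fderiv ℝ (η a) z v = ∑ a, fderiv ℝ u z v a • fderiv ℝ (η a) z w := by
  have second_fderiv : ∀ v w, fderiv ℝ (fderiv ℝ f) z v w
      = ∑ a, fderiv ℝ u z w a • fderiv ℝ (η a) z v
        + ∑ a, fderiv ℝ (fderiv ℝ u) z v w a • η a z := by
    intro v w
    have h := HasFDerivAt.fun_sum (u := Finset.univ) fun a _ =>
      ((EuclideanSpace.proj a : Coord q →L[ℝ] ℝ).hasFDerivAt.comp z
        (hasFDerivAt_fderiv_apply hu w)).smul (hη a).hasFDerivAt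
    have h' := (hasFDerivAt_fderiv_apply hf w).congr_of_eventuallyEq
      (hfη.mono fun y hy => (hy w).symm)
    simpa [Finset.sum_add_distrib] using DFunLike.congr_fun (h'.unique h) v
  have hfs := (hf.isSymmSndFDerivAt (by simp)) v w
  rw [second_fderiv, second_fderiv, (hu.isSymmSndFDerivAt (by simp)) v w] at hfs
  exact add_right_cancel hfs

lemma fderiv_comp_eq_partialDeriv {φ : Coord q → ℝ} {u : E → Coord q} {z v : E} {a : Fin q}
    (hφ : DifferentiableAt ℝ φ (u z)) (hu : DifferentiableAt ℝ u z)
    (hv : fderiv ℝ u z v = EuclideanSpace.single a 1) :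
    fderiv ℝ (fun y => φ (u y)) z v = partialDeriv a φ (u z) := by
  rw [fderiv_fun_comp z hφ hu, ContinuousLinearMap.comp_apply, hv, partialDeriv]

section

variable {κ ι : Type*} [Fintype κ] [Fintype ι] [DecidableEq ι] {A : E → Matrix κ κ ℝ}
  {t : E → (ι → κ) → ℝ} {z : E}

lemma hasFDerivAt_tensorAction_apply
    (hA : ∀ x d, DifferentiableAt ℝ (fun y => A y x d) z) (ht : DifferentiableAt ℝ t z)
    (c : ι → κ) :
    HasFDerivAt (fun y => tensorAction (A y) (t y) c)
      (∑ j, ∑ d, (A z (c j) d • (ContinuousLinearMap.proj (Function.update c j d) ∘L fderiv ℝ t z)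
        + t z (Function.update c j d) • fderiv ℝ (fun y => A y (c j) d) z)) z :=
  HasFDerivAt.fun_sum fun j _ => HasFDerivAt.fun_sum fun d _ =>
    (hA (c j) d).hasFDerivAt.mul (hasFDerivAt_pi'.1 ht.hasFDerivAt _)

lemma differentiableAt_tensorAction
    (hA : ∀ x d, DifferentiableAt ℝ (fun y => A y x d) z) (ht : DifferentiableAt ℝ t z) :
    DifferentiableAt ℝ (fun y => tensorAction (A y) (t y)) z :=
  differentiableAt_pi.2 fun c => (hasFDerivAt_tensorAction_apply hA ht c).differentiableAt

lemma fderiv_tensorAction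
    (hA : ∀ x d, DifferentiableAt ℝ (fun y => A y x d) z) (ht : DifferentiableAt ℝ t z) (v : E) :
    fderiv ℝ (fun y => tensorAction (A y) (t y)) z v
      = tensorAction (Matrix.of fun x d => fderiv ℝ (fun y => A y x d) z v) (t z)
        + tensorAction (A z) (fderiv ℝ t z v) := by
  funext c
  rw [fderiv_pi fun c => (hasFDerivAt_tensorAction_apply hA ht c).differentiableAt,
    ContinuousLinearMap.pi_apply, (hasFDerivAt_tensorAction_apply hA ht c).fderiv]
  simp [tensorAction_apply, Finset.sum_add_distrib, add_comm, mul_comm]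

end

/-- The curvature of the connection `∇_{∂_a} ∂_b = ∑ d, Γ_a b d ∂_d` in two coordinate directions.
Matrices act on coordinate vectors from the right, which reverses the order of the factors of the
usual commutator `Γ_a Γ_b - Γ_b Γ_a`. -/
def connectionCurvature (Γ : Fin q → Coord q → Matrix (Fin q) (Fin q) ℝ) (a b : Fin q)
    (z : Coord q) : Matrix (Fin q) (Fin q) ℝ :=
  Matrix.of (fun c d => partialDeriv a (fun y => Γ b y c d) z)
    - Matrix.of (fun c d => partialDeriv b (fun y => Γ a y c d) z) + ⁅Γ b z, Γ a z⁆

theorem tensorAction_connectionCurvature_eq_zero {ι : Type*} [Fintype ι] [DecidableEq ι]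
    {Γ : Fin q → Coord q → Matrix (Fin q) (Fin q) ℝ} {u : E → Coord q}
    {t : E → (ι → Fin q) → ℝ} {z : E}
    (hΓ : ∀ a b d, DifferentiableAt ℝ (fun y => Γ a y b d) (u z)) (hu : ContDiffAt ℝ 2 u z)
    (ht : ContDiffAt ℝ 2 t z) (hsurj : Function.Surjective (fderiv ℝ u z))
    (hpar : ∀ᶠ y in 𝓝 z, ∀ v,
      fderiv ℝ t y v = ∑ a, fderiv ℝ u y v a • tensorAction (Γ a (u y)) (t y))
    (a b : Fin q) :
    tensorAction (connectionCurvature Γ a b (u z)) (t z) = 0 := by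
  have hu' := hu.differentiableAt two_ne_zero
  have ht' := ht.differentiableAt two_ne_zero
  have hΓu : ∀ a b d, DifferentiableAt ℝ (fun y => Γ a (u y) b d) z := fun a b d =>
    (hΓ a b d).comp z hu'
  have sum_single : ∀ {v : E} {a : Fin q} (X : Fin q → (ι → Fin q) → ℝ),
      fderiv ℝ u z v = EuclideanSpace.single a 1 → ∑ b, fderiv ℝ u z v b • X b = X a := by
    intro v a X hv
    simp [hv, PiLp.single_apply]
  have fderiv_action : ∀ {v : E} {a : Fin q} (b : Fin q),
      fderiv ℝ u z v = EuclideanSpace.single a 1 →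
        fderiv ℝ (fun y => tensorAction (Γ b (u y)) (t y)) z v
          = tensorAction (Matrix.of fun c d => partialDeriv a (fun y => Γ b y c d) (u z)) (t z)
            + tensorAction (Γ b (u z)) (tensorAction (Γ a (u z)) (t z)) := by
    intro v a b hv
    rw [fderiv_tensorAction (hΓu b) ht', hpar.self_of_nhds v, sum_single _ hv]
    simp only [fderiv_comp_eq_partialDeriv (hΓ _ _ _) hu' hv]
  obtain ⟨v, hv⟩ := hsurj (EuclideanSpace.single a 1)
  obtain ⟨w, hw⟩ := hsurj (EuclideanSpace.single b 1)
  have closed := sum_smul_fderiv_comm_of_fderiv_eq ht hu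
    (fun a => differentiableAt_tensorAction (hΓu a) ht') hpar v w
  rw [sum_single _ hw, sum_single _ hv, fderiv_action b hv, fderiv_action a hw] at closed
  rw [connectionCurvature, map_add, map_sub, LinearMap.add_apply, LinearMap.sub_apply,
    tensorAction_lie]
  linear_combination closed

end FlatSections

section MatrixInverse

variable {E H X κ : Type*} [NormedAddCommGroup E] [NormedSpace ℝ E] [TopologicalSpace H]
  {I : ModelWithCorners ℝ E H} [TopologicalSpace X] [ChartedSpace H X] [Fintype κ] [DecidableEq κ]
  {n : WithTop ℕ∞} {A : X → Matrix κ κ ℝ} {x : X}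

lemma contMDiffAt_matrix_det (hA : ∀ a b, ContMDiffAt I 𝓘(ℝ, ℝ) n (fun y => A y a b) x) :
    ContMDiffAt I 𝓘(ℝ, ℝ) n (fun y => (A y).det) x := by
  simp only [Matrix.det_apply']
  exact ContMDiffAt.sum fun σ _ =>
    contMDiffAt_const.mul (ContMDiffAt.prod fun i _ => hA _ _)

lemma contMDiffAt_matrix_inv (hA : ∀ a b, ContMDiffAt I 𝓘(ℝ, ℝ) n (fun y => A y a b) x)
    (hdet : IsUnit (A x).det) (a b : κ) : ContMDiffAt I 𝓘(ℝ, ℝ) n (fun y => (A y)⁻¹ a b) x := by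
  simp only [Matrix.inv_def, Matrix.smul_apply, Ring.inverse_eq_inv', smul_eq_mul,
    Matrix.adjugate_apply]
  refine ((contMDiffAt_matrix_det hA).inv₀ hdet.ne_zero).mul
    (contMDiffAt_matrix_det fun c d => ?_)
  rcases eq_or_ne c b with rfl | hc
  · simpa only [Matrix.updateRow_self] using contMDiffAt_const
  · simpa only [Matrix.updateRow_ne hc] using hA c d

end MatrixInverse

lemma sum_smul_single {n : ℕ} (v : Coord n) :
    ∑ a, v a • (EuclideanSpace.single a 1 : Coord n) = v := by
  simpa using (EuclideanSpace.basisFun (Fin n) ℝ).sum_repr v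

section Chart

variable {n : ℕ} {X : Type*} [TopologicalSpace X] [ChartedSpace (Coord n) X]
  {V : Type*} [NormedAddCommGroup V] [NormedSpace ℝ V] {x₀ x : X}

/-- The coordinate vector field `∂_a` of the chart at `x₀`. -/
def coordField (x₀ : X) (a : Fin n) (x : X) : TangentSpace (𝓡 n) x :=
  mfderiv 𝓘(ℝ, Coord n) (𝓡 n) (extChartAt (𝓡 n) x₀).symm (extChartAt (𝓡 n) x₀ x)
    (EuclideanSpace.single a 1)

variable [IsManifold (𝓡 n) ∞ X]

lemma contDiffAt_comp_extChartAt_symm {k : ℕ∞} {f : X → V}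
    (hx : x ∈ (extChartAt (𝓡 n) x₀).source) (hf : ContMDiffAt (𝓡 n) 𝓘(ℝ, V) k f x) :
    ContDiffAt ℝ k (f ∘ (extChartAt (𝓡 n) x₀).symm) (extChartAt (𝓡 n) x₀ x) := by
  rw [← contMDiffAt_iff_contDiffAt]
  refine ContMDiffAt.comp (I' := 𝓡 n) _ ?_ ?_
  · rwa [(extChartAt (𝓡 n) x₀).left_inv hx]
  · exact ((contMDiffOn_extChartAt_symm (n := ∞) x₀).contMDiffAt
      (extChartAt_target_mem_nhds' ((extChartAt (𝓡 n) x₀).map_source hx))).of_le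
        (by exact_mod_cast le_top)

lemma mfderiv_extChartAt_mfderiv_symm (hx : x ∈ (extChartAt (𝓡 n) x₀).source) (v : Coord n) :
    mfderiv (𝓡 n) 𝓘(ℝ, Coord n) (extChartAt (𝓡 n) x₀) x
      (mfderiv 𝓘(ℝ, Coord n) (𝓡 n) (extChartAt (𝓡 n) x₀).symm (extChartAt (𝓡 n) x₀ x) v) = v := by
  have : IsManifold (𝓡 n) 1 X := IsManifold.of_le (n := ∞) (by norm_num)
  have := mfderiv_extChartAt_comp_mfderivWithin_extChartAt_symm' (I := 𝓡 n) hx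
  simp only [modelWithCornersSelf_coe, range_id, mfderivWithin_univ] at this
  exact DFunLike.congr_fun this v

lemma mfderiv_extChartAt_coordField (hx : x ∈ (extChartAt (𝓡 n) x₀).source) (a : Fin n) :
    mfderiv (𝓡 n) 𝓘(ℝ, Coord n) (extChartAt (𝓡 n) x₀) x (coordField x₀ a x)
      = EuclideanSpace.single a (1 : ℝ) :=
  mfderiv_extChartAt_mfderiv_symm hx _

lemma injective_mfderiv_extChartAt (hx : x ∈ (extChartAt (𝓡 n) x₀).source) :
    Function.Injective (mfderiv (𝓡 n) 𝓘(ℝ, Coord n) (extChartAt (𝓡 n) x₀) x) := by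
  have : IsManifold (𝓡 n) 1 X := IsManifold.of_le (n := ∞) (by norm_num)
  exact (isInvertible_mfderiv_extChartAt hx).injective

lemma sum_smul_coordField (hx : x ∈ (extChartAt (𝓡 n) x₀).source)
    (v : TangentSpace (𝓡 n) x) :
    ∑ a, (EuclideanSpace.proj a : Coord n →L[ℝ] ℝ)
      (mfderiv (𝓡 n) 𝓘(ℝ, Coord n) (extChartAt (𝓡 n) x₀) x v) • coordField x₀ a x = v := by
  apply injective_mfderiv_extChartAt hx
  simp only [map_sum, map_smul, mfderiv_extChartAt_coordField hx]
  exact sum_smul_single _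

lemma fderiv_comp_extChartAt_symm {f : X → V} (hx : x ∈ (extChartAt (𝓡 n) x₀).source)
    (hf : MDifferentiableAt (𝓡 n) 𝓘(ℝ, V) f x) (v : Coord n) :
    fderiv ℝ (f ∘ (extChartAt (𝓡 n) x₀).symm) (extChartAt (𝓡 n) x₀ x) v
      = mfderiv (𝓡 n) 𝓘(ℝ, V) f x (mfderiv 𝓘(ℝ, Coord n) (𝓡 n) (extChartAt (𝓡 n) x₀).symm
          (extChartAt (𝓡 n) x₀ x) v) := by
  have : IsManifold (𝓡 n) 1 X := IsManifold.of_le (n := ∞) (by norm_num)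
  have hinv := (extChartAt (𝓡 n) x₀).left_inv hx
  have hs : MDifferentiableAt 𝓘(ℝ, Coord n) (𝓡 n) (extChartAt (𝓡 n) x₀).symm
      (extChartAt (𝓡 n) x₀ x) := by
    simpa only [modelWithCornersSelf_coe, range_id, mdifferentiableWithinAt_univ] using
      mdifferentiableWithinAt_extChartAt_symm (I := 𝓡 n) ((extChartAt (𝓡 n) x₀).map_source hx)
  rw [← mfderiv_eq_fderiv, mfderiv_comp (I' := 𝓡 n) _ (by rwa [hinv]) hs, hinv]
  rfl

lemma surjective_fderiv_comp_extChartAt_symm {f : X → V}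
    (hx : x ∈ (extChartAt (𝓡 n) x₀).source) (hf : MDifferentiableAt (𝓡 n) 𝓘(ℝ, V) f x)
    (hsurj : Function.Surjective (mfderiv (𝓡 n) 𝓘(ℝ, V) f x)) :
    Function.Surjective
      (fderiv ℝ (f ∘ (extChartAt (𝓡 n) x₀).symm) (extChartAt (𝓡 n) x₀ x)) := by
  intro w
  obtain ⟨v, rfl⟩ := hsurj w
  exact ⟨mfderiv (𝓡 n) 𝓘(ℝ, Coord n) (extChartAt (𝓡 n) x₀) x v,
    (fderiv_comp_extChartAt_symm hx hf _).trans (congrArg _ (injective_mfderiv_extChartAt hx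
      (mfderiv_extChartAt_mfderiv_symm hx _)))⟩

lemma contMDiffAt_coordField (hx : x ∈ (extChartAt (𝓡 n) x₀).source) (a : Fin n) :
    ContMDiffAt (𝓡 n) (𝓡 n).tangent ∞
      (fun y => (⟨y, coordField x₀ a y⟩ : TangentBundle (𝓡 n) X)) x := by
  have : IsManifold (𝓡 n) 1 X := IsManifold.of_le (n := ∞) (by norm_num)
  have base_mem : ∀ y ∈ (extChartAt (𝓡 n) x₀).source,
      y ∈ (trivializationAt (Coord n) (TangentSpace (𝓡 n)) x₀).baseSet := by simp
  refine ((trivializationAt (Coord n) (TangentSpace (𝓡 n)) x₀).contMDiffAt_section_iff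
    (base_mem x hx)).2 ((contMDiffAt_const (c := (EuclideanSpace.single a 1 : Coord n)))
      |>.congr_of_eventuallyEq ?_)
  filter_upwards [(isOpen_extChartAt_source x₀).mem_nhds hx] with y hy
  have h := TangentBundle.continuousLinearMapAt_trivializationAt (I := 𝓡 n) (x₀ := x₀) (x := y)
    (by simpa using hy)
  refine Eq.trans ?_ ((DFunLike.congr_fun h (coordField x₀ a y)).trans
    (mfderiv_extChartAt_coordField hy a))
  rw [Trivialization.continuousLinearMapAt_apply, Trivialization.linearMapAt_apply,
    if_pos (base_mem y hy)]

lemma contMDiffOn_mfderiv_apply {f : X → V} {Y : ∀ x : X, TangentSpace (𝓡 n) x} {s : Set X}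
    (hs : IsOpen s) (hf : ContMDiffOn (𝓡 n) 𝓘(ℝ, V) ∞ f s)
    (hY : ContMDiffOn (𝓡 n) (𝓡 n).tangent ∞ (fun y => (⟨y, Y y⟩ : TangentBundle (𝓡 n) X)) s) :
    ContMDiffOn (𝓡 n) 𝓘(ℝ, V) ∞ (fun y => mfderiv (𝓡 n) 𝓘(ℝ, V) f y (Y y)) s := by
  have : IsManifold (𝓡 n) 1 X := IsManifold.of_le (n := ∞) (by norm_num)
  have h := (hf.contMDiffOn_tangentMapWithin (m := ∞) (by simp) hs.uniqueMDiffOn).comp hY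
    fun _ hy => hy
  refine ((contMDiff_snd_tangentBundle_modelSpace V 𝓘(ℝ, V)).comp_contMDiffOn h).congr
    fun y hy => ?_
  rw [← mfderivWithin_of_isOpen hs hy]
  rfl

variable (g : TangentMetric n X)

lemma contMDiffOn_metric_apply {Y Z : ∀ x : X, TangentSpace (𝓡 n) x} {s : Set X}
    (hY : ContMDiffOn (𝓡 n) (𝓡 n).tangent ∞ (fun y => (⟨y, Y y⟩ : TangentBundle (𝓡 n) X)) s)
    (hZ : ContMDiffOn (𝓡 n) (𝓡 n).tangent ∞ (fun y => (⟨y, Z y⟩ : TangentBundle (𝓡 n) X)) s) :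
    ContMDiffOn (𝓡 n) 𝓘(ℝ, ℝ) ∞ (fun y => g.inner y (Y y) (Z y)) s := by
  have h : ContMDiffOn (𝓡 n) ((𝓡 n).prod 𝓘(ℝ, ℝ)) ∞
      (fun y => (⟨y, g.inner y (Y y) (Z y)⟩ : TotalSpace ℝ (Bundle.Trivial X ℝ))) s :=
    ContMDiffOn.clm_bundle_apply₂ (F₁ := Coord n) (F₂ := Coord n) g.contMDiff.contMDiffOn hY hZ
  exact fun y hy => (contMDiffWithinAt_totalSpace.1 (h y hy)).2

end Chart

section LeviCivita

variable {q : ℕ} {N : Type*} [TopologicalSpace N] [ChartedSpace (Coord q) N]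

lemma fderiv_eq_sum_partialDeriv (f : Coord q → ℝ) (z v : Coord q) :
    fderiv ℝ f z v = ∑ a, v a * partialDeriv a f z := by
  conv_lhs => rw [← sum_smul_single v]
  simp [partialDeriv]

lemma contDiffAt_partialDeriv {f : Coord q → ℝ} {z : Coord q} (a : Fin q)
    (hf : ContDiffAt ℝ ∞ f z) : ContDiffAt ℝ ∞ (partialDeriv a f) z :=
  (hf.fderiv_right (m := ∞) (by simp)).clm_apply contDiffAt_const

variable [IsManifold (𝓡 q) ∞ N] (g : TangentMetric q N) (y₀ : N) {z : Coord q}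

lemma metricCoeff_eq_inner_coordField (hz : z ∈ (extChartAt (𝓡 q) y₀).target) (a b : Fin q) :
    metricCoeff g y₀ z a b = g.inner ((extChartAt (𝓡 q) y₀).symm z)
      (coordField y₀ a ((extChartAt (𝓡 q) y₀).symm z))
      (coordField y₀ b ((extChartAt (𝓡 q) y₀).symm z)) := by
  rw [coordField, coordField, (extChartAt (𝓡 q) y₀).right_inv hz]
  rfl

lemma contDiffAt_metricCoeff (hz : z ∈ (extChartAt (𝓡 q) y₀).target) (a b : Fin q) :
    ContDiffAt ℝ ∞ (fun w => metricCoeff g y₀ w a b) z := by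
  have hy := (extChartAt (𝓡 q) y₀).map_target hz
  have smooth_coordField : ∀ a, ContMDiffOn (𝓡 q) (𝓡 q).tangent ∞
      (fun y => (⟨y, coordField y₀ a y⟩ : TangentBundle (𝓡 q) N)) (extChartAt (𝓡 q) y₀).source :=
    fun a y hy => (contMDiffAt_coordField hy a).contMDiffWithinAt
  have h := contDiffAt_comp_extChartAt_symm hy
    ((contMDiffOn_metric_apply g (smooth_coordField a) (smooth_coordField b)).contMDiffAt
      ((isOpen_extChartAt_source y₀).mem_nhds hy))
  rw [(extChartAt (𝓡 q) y₀).right_inv hz] at h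
  refine h.congr_of_eventuallyEq ?_
  filter_upwards [(isOpen_extChartAt_target y₀).mem_nhds hz] with w hw
  exact metricCoeff_eq_inner_coordField g y₀ hw a b

lemma metricCoeff_symm (z : Coord q) (a b : Fin q) :
    metricCoeff g y₀ z a b = metricCoeff g y₀ z b a :=
  g.symm _ _ _

lemma posDef_metricCoeff (hz : z ∈ (extChartAt (𝓡 q) y₀).target) :
    (metricCoeff g y₀ z).PosDef := by
  have hy := (extChartAt (𝓡 q) y₀).map_target hz
  refine Matrix.PosDef.of_dotProduct_mulVec_pos
    (Matrix.ext fun a b => metricCoeff_symm g y₀ z b a) fun v hv => ?_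
  have hne : ∑ a, v a • coordField y₀ a ((extChartAt (𝓡 q) y₀).symm z) ≠ 0 := by
    intro h
    have h' := congrArg
      (mfderiv (𝓡 q) 𝓘(ℝ, Coord q) (extChartAt (𝓡 q) y₀) ((extChartAt (𝓡 q) y₀).symm z)) h
    simp only [map_sum, map_smul, map_zero, mfderiv_extChartAt_coordField hy] at h'
    exact hv (congrArg WithLp.ofLp ((sum_smul_single (WithLp.toLp 2 v)).symm.trans h'))
  have hpos := g.pos _ _ hne
  simp only [map_sum, map_smul, sum_apply, smul_apply, smul_eq_mul,
    ← metricCoeff_eq_inner_coordField g y₀ hz] at hpos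
  simpa only [dotProduct, Matrix.mulVec, star_trivial, mul_comm (metricCoeff g y₀ z _ _),
    metricCoeff_symm g y₀ z] using hpos

lemma isUnit_det_metricCoeff (hz : z ∈ (extChartAt (𝓡 q) y₀).target) :
    IsUnit (metricCoeff g y₀ z).det :=
  (posDef_metricCoeff g y₀ hz).det_pos.ne'.isUnit

lemma transpose_metricInv (z : Coord q) : (metricInv g y₀ z).transpose = metricInv g y₀ z := by
  rw [metricInv, Matrix.transpose_nonsing_inv]
  exact congrArg _ (Matrix.ext fun a b => metricCoeff_symm g y₀ z b a)

lemma contDiffAt_metricInv (hz : z ∈ (extChartAt (𝓡 q) y₀).target) (a b : Fin q) :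
    ContDiffAt ℝ ∞ (fun w => metricInv g y₀ w a b) z :=
  (contMDiffAt_matrix_inv (fun a b => (contDiffAt_metricCoeff g y₀ hz a b).contMDiffAt)
    (isUnit_det_metricCoeff g y₀ hz) a b).contDiffAt

lemma contDiffAt_christoffel (hz : z ∈ (extChartAt (𝓡 q) y₀).target) (a b d : Fin q) :
    ContDiffAt ℝ ∞ (christoffel g y₀ a b d) z := by
  have h := contDiffAt_metricCoeff g y₀ hz
  unfold christoffel
  exact contDiffAt_const.mul (ContDiffAt.sum fun k _ => (contDiffAt_metricInv g y₀ hz d k).mul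
    (((contDiffAt_partialDeriv a (h b k)).add (contDiffAt_partialDeriv b (h a k))).sub
      (contDiffAt_partialDeriv k (h a b))))

lemma christoffel_symm (a b d : Fin q) : christoffel g y₀ a b d = christoffel g y₀ b a d := by
  funext z
  refine congrArg _ (Finset.sum_congr rfl fun k _ => ?_)
  simp only [metricCoeff_symm g y₀ _ a b]
  ring

lemma vecMul_mulVec_metricInv_metricCoeff (hz : z ∈ (extChartAt (𝓡 q) y₀).target)
    (α : Fin q → ℝ) :
    Matrix.vecMul (Matrix.mulVec (metricInv g y₀ z) α) (metricCoeff g y₀ z) = α := by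
  rw [← Matrix.vecMul_transpose, transpose_metricInv, Matrix.vecMul_vecMul, metricInv,
    Matrix.nonsing_inv_mul _ (isUnit_det_metricCoeff g y₀ hz), Matrix.vecMul_one]

lemma sum_christoffel_mul_metricCoeff (hz : z ∈ (extChartAt (𝓡 q) y₀).target) (a b k : Fin q) :
    ∑ d, christoffel g y₀ a b d z * metricCoeff g y₀ z d k
      = (1 / 2) * (partialDeriv a (fun w => metricCoeff g y₀ w b k) z
        + partialDeriv b (fun w => metricCoeff g y₀ w a k) z
        - partialDeriv k (fun w => metricCoeff g y₀ w a b) z) := by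
  simp only [christoffel, mul_assoc, ← Finset.mul_sum]
  exact congrArg _ (congrFun (vecMul_mulVec_metricInv_metricCoeff g y₀ hz _) k)

lemma partialDeriv_metricCoeff (hz : z ∈ (extChartAt (𝓡 q) y₀).target) (a b c : Fin q) :
    partialDeriv a (fun w => metricCoeff g y₀ w b c) z
      = ∑ d, christoffel g y₀ a b d z * metricCoeff g y₀ z d c
        + ∑ d, christoffel g y₀ a c d z * metricCoeff g y₀ z b d := by
  simp only [metricCoeff_symm g y₀ z b]
  rw [sum_christoffel_mul_metricCoeff g y₀ hz, sum_christoffel_mul_metricCoeff g y₀ hz]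
  simp only [metricCoeff_symm g y₀ _ c b]
  ring

/-- The matrix of `∇_{∂_a}` on the coordinate frame, i.e. `(Γ^d_{ab})_{b,d}`. -/
def christoffelMatrix (a : Fin q) (z : Coord q) : Matrix (Fin q) (Fin q) ℝ :=
  Matrix.of fun b d => christoffel g y₀ a b d z

lemma connectionCurvature_christoffelMatrix (a b c d : Fin q) :
    connectionCurvature (christoffelMatrix g y₀) a b z c d = curvCoeff g y₀ a b c d z := by
  simp [connectionCurvature, christoffelMatrix, curvCoeff, Ring.lie_def, Matrix.mul_apply,
    Finset.sum_sub_distrib, mul_comm]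

lemma fderiv_metricCoeff_eq_tensorAction (hz : z ∈ (extChartAt (𝓡 q) y₀).target) (v : Coord q) :
    fderiv ℝ (fun w (c : Fin 2 → Fin q) => metricCoeff g y₀ w (c 0) (c 1)) z v
      = ∑ a, v a • tensorAction (christoffelMatrix g y₀ a z)
          fun c => metricCoeff g y₀ z (c 0) (c 1) := by
  funext c
  rw [fderiv_pi fun c => (contDiffAt_metricCoeff g y₀ hz _ _).differentiableAt (by simp),
    ContinuousLinearMap.pi_apply, fderiv_eq_sum_partialDeriv]
  simp [partialDeriv_metricCoeff g y₀ hz, tensorAction_apply, christoffelMatrix,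
    Fin.sum_univ_two]

lemma riemann_antisymm_right (hz : z ∈ (extChartAt (𝓡 q) y₀).target) (a b c d : Fin q) :
    riemann g y₀ a b c d z = - riemann g y₀ a b d c z := by
  have h := tensorAction_connectionCurvature_eq_zero (Γ := christoffelMatrix g y₀) (u := id)
    (t := fun w (c : Fin 2 → Fin q) => metricCoeff g y₀ w (c 0) (c 1)) (z := z)
    (fun a b d => (contDiffAt_christoffel g y₀ hz a b d).differentiableAt (by simp))
    contDiffAt_id
    (contDiffAt_pi.2 fun c => (contDiffAt_metricCoeff g y₀ hz _ _).of_le (by norm_cast))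
    (by rw [fderiv_id]; exact Function.surjective_id)
    (by
      filter_upwards [(isOpen_extChartAt_target y₀).mem_nhds hz] with y hy v
      rw [fderiv_id]
      exact fderiv_metricCoeff_eq_tensorAction g y₀ hy v) a b
  have h' := congrFun h ![d, c]
  simp only [id_eq, tensorAction_apply, connectionCurvature_christoffelMatrix, Fin.sum_univ_two,
    Matrix.cons_val_zero, Matrix.cons_val_one, Matrix.cons_val_fin_one, Function.update_self,
    Function.update_of_ne one_ne_zero, Function.update_of_ne zero_ne_one, metricCoeff_symm g y₀ z d,
    Pi.zero_apply] at h'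
  exact eq_neg_of_add_eq_zero_left h'

lemma riemann_antisymm_left (a b c d : Fin q) (z : Coord q) :
    riemann g y₀ a b c d z = - riemann g y₀ b a c d z := by
  simp only [riemann, curvCoeff, Finset.sum_sub_distrib, ← Finset.sum_neg_distrib]
  exact Finset.sum_congr rfl fun e _ => by ring

lemma curvCoeff_bianchi (a b c d : Fin q) (z : Coord q) :
    curvCoeff g y₀ a b c d z + curvCoeff g y₀ b c a d z + curvCoeff g y₀ c a b d z = 0 := by
  simp only [curvCoeff, Finset.sum_sub_distrib, christoffel_symm g y₀ c b,
    christoffel_symm g y₀ c a, christoffel_symm g y₀ b a]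
  ring

lemma riemann_bianchi (a b c d : Fin q) (z : Coord q) :
    riemann g y₀ a b c d z + riemann g y₀ b d c a z + riemann g y₀ d a c b z = 0 := by
  simp only [riemann, ← Finset.sum_add_distrib, ← add_mul, curvCoeff_bianchi, zero_mul,
    Finset.sum_const_zero]

lemma riemann_pair_symm (hz : z ∈ (extChartAt (𝓡 q) y₀).target) (a b c d : Fin q) :
    riemann g y₀ a b c d z = riemann g y₀ c d a b z := by
  have R := riemann_antisymm_right g y₀ hz
  have L := fun a b c d => riemann_antisymm_left g y₀ a b c d z
  have B := fun a b c d => riemann_bianchi g y₀ a b c d z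
  linarith [B a b c d, B b c d a, B c d a b, B d a b c, R b d c a, L d a c b, R a d c b, R b c d a,
    L c a d b, R a c d b, R a b d c, L d b a c, L d a b c, R c d b a]

lemma sum_riemann_mul_metricInv (hz : z ∈ (extChartAt (𝓡 q) y₀).target) (a b c d : Fin q) :
    ∑ e, riemann g y₀ a b e c z * metricInv g y₀ z e d = curvCoeff g y₀ a b c d z := by
  have h : Matrix.vecMul (Matrix.vecMul (fun e => curvCoeff g y₀ a b c e z) (metricCoeff g y₀ z))
      (metricInv g y₀ z) = fun e => curvCoeff g y₀ a b c e z := by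
    rw [Matrix.vecMul_vecMul, metricInv,
      Matrix.mul_nonsing_inv _ (isUnit_det_metricCoeff g y₀ hz), Matrix.vecMul_one]
  exact congrFun h d

/-- The curvature with the second index of each pair raised, `R_a^b_c^d`, as a matrix in `c`, `d`.
It is the `Ω` for which the Ricci and curvature terms of the Laplacian sum to `-casimirAction Ω`. -/
def raisedRiemann (z : Coord q) (a b : Fin q) : Matrix (Fin q) (Fin q) ℝ :=
  Matrix.of fun c d => ∑ A, ∑ B,
    riemann g y₀ a A c B z * metricInv g y₀ z A b * metricInv g y₀ z B d

lemma raisedRiemann_pair_symm (hz : z ∈ (extChartAt (𝓡 q) y₀).target) (a b c d : Fin q) :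
    raisedRiemann g y₀ z a b c d = raisedRiemann g y₀ z c d a b := by
  simp only [raisedRiemann, Matrix.of_apply, riemann_pair_symm g y₀ hz a]
  rw [Finset.sum_comm]
  exact Finset.sum_congr rfl fun A _ => Finset.sum_congr rfl fun B _ => mul_right_comm _ _ _

lemma raisedRiemann_eq_sum_connectionCurvature (hz : z ∈ (extChartAt (𝓡 q) y₀).target)
    (a b : Fin q) :
    raisedRiemann g y₀ z a b
      = -∑ A, metricInv g y₀ z A b • connectionCurvature (christoffelMatrix g y₀) a A z := by
  ext c d
  simp only [raisedRiemann, Matrix.of_apply, Matrix.neg_apply, Matrix.sum_apply,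
    Matrix.smul_apply, connectionCurvature_christoffelMatrix, smul_eq_mul,
    ← sum_riemann_mul_metricInv g y₀ hz, Finset.mul_sum, ← Finset.sum_neg_distrib]
  refine Finset.sum_congr rfl fun A _ => Finset.sum_congr rfl fun B _ => ?_
  rw [riemann_antisymm_right g y₀ hz]
  ring

lemma sum_raisedRiemann_eq_neg_ricci (hz : z ∈ (extChartAt (𝓡 q) y₀).target) (a d : Fin q) :
    ∑ b, raisedRiemann g y₀ z a b b d = -∑ B, ricci g y₀ a B z * metricInv g y₀ z B d := by
  have ricci_eq : ∀ B, ricci g y₀ a B z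
      = -∑ b, ∑ A, riemann g y₀ a A b B z * metricInv g y₀ z A b := by
    intro B
    simp only [ricci, ← sum_riemann_mul_metricInv g y₀ hz, ← Finset.sum_neg_distrib]
    rw [Finset.sum_comm]
    refine Finset.sum_congr rfl fun b _ => Finset.sum_congr rfl fun A _ => ?_
    rw [riemann_antisymm_left, ← Matrix.transpose_apply (metricInv g y₀ z), transpose_metricInv,
      neg_mul]
  simp only [raisedRiemann, Matrix.of_apply, ricci_eq, neg_mul, Finset.sum_neg_distrib, neg_neg,
    Finset.sum_mul]
  rw [Finset.sum_comm (s := Finset.univ (α := Fin q)) (t := Finset.univ (α := Fin q))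
    (f := fun B b => ∑ A, riemann g y₀ a A b B z * metricInv g y₀ z A b * metricInv g y₀ z B d)]
  exact Finset.sum_congr rfl fun b _ => Finset.sum_comm

end LeviCivita

section HorizontalLift

variable {n q : ℕ} {X : Type*} [TopologicalSpace X] [ChartedSpace (Coord n) X]
  {x₀ x : X} {s : Set X} {u : X → Coord q}

lemma dirDeriv_sum_smul {κ : Type*} [Fintype κ] (f : X → ℝ) (r : κ → ℝ)
    (v : κ → TangentSpace (𝓡 n) x) :
    dirDeriv f x (∑ k, r k • v k) = ∑ k, r k * dirDeriv f x (v k) := by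
  simp only [dirDeriv, map_sum, map_smul]
  rfl

lemma dirDeriv_component (hu : MDifferentiableAt (𝓡 n) 𝓘(ℝ, Coord q) u x) (a : Fin q)
    (v : TangentSpace (𝓡 n) x) :
    dirDeriv (fun y => u y a) x v
      = (EuclideanSpace.proj a : Coord q →L[ℝ] ℝ) (mfderiv (𝓡 n) 𝓘(ℝ, Coord q) u x v) :=
  DFunLike.congr_fun ((((EuclideanSpace.proj a : Coord q →L[ℝ] ℝ).hasMFDerivAt).comp x
    hu.hasMFDerivAt).mfderiv) v

variable [IsManifold (𝓡 n) ∞ X] (g : TangentMetric n X)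

/-- The gradient of `f` with respect to `g`, expressed in the chart at `x₀`. -/
def metricGradient (x₀ : X) (f : X → ℝ) (x : X) : TangentSpace (𝓡 n) x :=
  ∑ i, (∑ j, metricInv g x₀ (extChartAt (𝓡 n) x₀ x) i j
    * dirDeriv f x (coordField x₀ j x)) • coordField x₀ i x

lemma inner_metricGradient (hx : x ∈ (extChartAt (𝓡 n) x₀).source) (f : X → ℝ)
    (v : TangentSpace (𝓡 n) x) :
    g.inner x (metricGradient g x₀ f x) v = dirDeriv f x v := by
  have hz := (extChartAt (𝓡 n) x₀).map_source hx
  have inner_coordField : ∀ i k, g.inner x (coordField x₀ i x) (coordField x₀ k x)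
      = metricCoeff g x₀ (extChartAt (𝓡 n) x₀ x) i k := fun i k => by
    rw [metricCoeff_eq_inner_coordField g x₀ hz, (extChartAt (𝓡 n) x₀).left_inv hx]
  have on_coordField : ∀ k, g.inner x (metricGradient g x₀ f x) (coordField x₀ k x)
      = dirDeriv f x (coordField x₀ k x) := fun k => by
    simp only [metricGradient, map_sum, map_smul, sum_apply, smul_apply, smul_eq_mul,
      inner_coordField]
    exact congrFun (vecMul_mulVec_metricInv_metricCoeff g x₀ hz
      fun j => dirDeriv f x (coordField x₀ j x)) k
  rw [← sum_smul_coordField hx v]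
  simp only [map_sum, map_smul, on_coordField, smul_eq_mul, dirDeriv_sum_smul]

lemma contMDiffOn_metricGradient {f : X → ℝ} (hs : IsOpen s)
    (hsub : s ⊆ (extChartAt (𝓡 n) x₀).source) (hf : ContMDiffOn (𝓡 n) 𝓘(ℝ, ℝ) ∞ f s) :
    ContMDiffOn (𝓡 n) (𝓡 n).tangent ∞
      (fun y => (⟨y, metricGradient g x₀ f y⟩ : TangentBundle (𝓡 n) X)) s := by
  have smooth_field : ∀ a, ContMDiffOn (𝓡 n) (𝓡 n).tangent ∞
      (fun y => (⟨y, coordField x₀ a y⟩ : TangentBundle (𝓡 n) X)) s :=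
    fun a y hy => (contMDiffAt_coordField (hsub hy) a).contMDiffWithinAt
  have smooth_inv : ∀ i j, ContMDiffOn (𝓡 n) 𝓘(ℝ, ℝ) ∞
      (fun y => metricInv g x₀ (extChartAt (𝓡 n) x₀ y) i j) s := fun i j y hy =>
    (ContMDiffAt.comp (I' := 𝓘(ℝ, Coord n)) y
      (contDiffAt_metricInv g x₀ ((extChartAt (𝓡 n) x₀).map_source (hsub hy)) i j).contMDiffAt
      (contMDiffAt_extChartAt' (by simpa using hsub hy))).contMDiffWithinAt
  exact ContMDiffOn.sum_section fun i _ => (contMDiffOn_finsetSum fun j _ =>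
    (smooth_inv i j).mul (contMDiffOn_mfderiv_apply hs hf (smooth_field j))).smul_section
      (smooth_field i)

/-- The Gram matrix `g(grad u_a, grad u_b)` of the components of `u`. -/
def gradientGram (x₀ : X) (u : X → Coord q) (x : X) : Matrix (Fin q) (Fin q) ℝ :=
  Matrix.of fun a b =>
    dirDeriv (fun y => u y a) x (metricGradient g x₀ (fun y => u y b) x)

/-- The horizontal lift of the coordinate vector `∂_a` under `u`: the combination of the gradients
of the components of `u` that `u` maps to `∂_a`. -/
def gradientLift (x₀ : X) (u : X → Coord q) (a : Fin q) (x : X) : TangentSpace (𝓡 n) x :=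
  ∑ b, (gradientGram g x₀ u x)⁻¹ b a • metricGradient g x₀ (fun y => u y b) x

lemma posDef_gradientGram (hx : x ∈ (extChartAt (𝓡 n) x₀).source)
    (hu : MDifferentiableAt (𝓡 n) 𝓘(ℝ, Coord q) u x)
    (hsurj : Function.Surjective (mfderiv (𝓡 n) 𝓘(ℝ, Coord q) u x)) :
    (gradientGram g x₀ u x).PosDef := by
  have inner_eq : ∀ a b, gradientGram g x₀ u x a b = g.inner x
      (metricGradient g x₀ (fun y => u y a) x) (metricGradient g x₀ (fun y => u y b) x) :=
    fun a b => (inner_metricGradient g hx _ _).symm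
  have gram_symm : ∀ a b, gradientGram g x₀ u x a b = gradientGram g x₀ u x b a :=
    fun a b => by rw [inner_eq, inner_eq, g.symm]
  refine Matrix.PosDef.of_dotProduct_mulVec_pos (Matrix.ext fun a b => gram_symm b a)
    fun v hv => ?_
  have hne : ∑ a, v a • metricGradient g x₀ (fun y => u y a) x ≠ 0 := by
    intro h
    obtain ⟨w, hw⟩ := hsurj (WithLp.toLp 2 v)
    have h' := congrArg (fun e => g.inner x e w) h
    simp only [map_sum, map_smul, sum_apply, smul_apply, inner_metricGradient g hx,
      dirDeriv_component hu, hw, map_zero, zero_apply] at h'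
    exact hv (dotProduct_self_eq_zero.1 h')
  have hpos := g.pos _ _ hne
  simpa only [map_sum, map_smul, sum_apply, smul_apply, smul_eq_mul, ← inner_eq, dotProduct,
    Matrix.mulVec, star_trivial, mul_comm (gradientGram g x₀ u x _ _), Finset.mul_sum,
    gram_symm] using hpos

lemma mfderiv_gradientLift (hx : x ∈ (extChartAt (𝓡 n) x₀).source)
    (hu : MDifferentiableAt (𝓡 n) 𝓘(ℝ, Coord q) u x)
    (hsurj : Function.Surjective (mfderiv (𝓡 n) 𝓘(ℝ, Coord q) u x)) (a : Fin q) :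
    mfderiv (𝓡 n) 𝓘(ℝ, Coord q) u x (gradientLift g x₀ u a x)
      = EuclideanSpace.single a (1 : ℝ) := by
  have h := Matrix.mul_nonsing_inv _
    (posDef_gradientGram g hx hu hsurj).det_pos.ne'.isUnit
  refine PiLp.ext fun c => ?_
  refine (dirDeriv_component hu c (gradientLift g x₀ u a x)).symm.trans ?_
  rw [gradientLift, dirDeriv_sum_smul]
  simp only [mul_comm ((gradientGram g x₀ u x)⁻¹ _ _)]
  exact (congrFun (congrFun h c) a).trans (by simp [Matrix.one_apply])

lemma inner_gradientLift_eq_zero (hx : x ∈ (extChartAt (𝓡 n) x₀).source)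
    (hu : MDifferentiableAt (𝓡 n) 𝓘(ℝ, Coord q) u x) (a : Fin q) {v : TangentSpace (𝓡 n) x}
    (hv : mfderiv (𝓡 n) 𝓘(ℝ, Coord q) u x v = 0) :
    g.inner x (gradientLift g x₀ u a x) v = 0 := by
  simp only [gradientLift, map_sum, map_smul, sum_apply, smul_apply, inner_metricGradient g hx,
    dirDeriv_component hu, hv]
  exact Finset.sum_eq_zero fun b _ => mul_zero _

lemma contMDiffOn_gradientLift (hs : IsOpen s) (hsub : s ⊆ (extChartAt (𝓡 n) x₀).source)
    (hu : ContMDiffOn (𝓡 n) 𝓘(ℝ, Coord q) ∞ u s)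
    (hsurj : ∀ y ∈ s, Function.Surjective (mfderiv (𝓡 n) 𝓘(ℝ, Coord q) u y)) (a : Fin q) :
    ContMDiffOn (𝓡 n) (𝓡 n).tangent ∞
      (fun y => (⟨y, gradientLift g x₀ u a y⟩ : TangentBundle (𝓡 n) X)) s := by
  have smooth_component : ∀ b, ContMDiffOn (𝓡 n) 𝓘(ℝ, ℝ) ∞ (fun y => u y b) s := fun b =>
    (EuclideanSpace.proj b : Coord q →L[ℝ] ℝ).contMDiff.comp_contMDiffOn hu
  have smooth_gradient := fun b =>
    contMDiffOn_metricGradient g hs hsub (smooth_component b)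
  refine ContMDiffOn.sum_section fun b _ => ContMDiffOn.smul_section (fun y hy => ?_)
    (smooth_gradient b)
  refine (contMDiffAt_matrix_inv (fun c d => ?_) (posDef_gradientGram g (hsub hy)
    ((hu.contMDiffAt (hs.mem_nhds hy)).mdifferentiableAt (by simp))
      (hsurj y hy)).det_pos.ne'.isUnit b a).contMDiffWithinAt
  exact (contMDiffOn_mfderiv_apply hs (smooth_component c) (smooth_gradient d)).contMDiffAt
    (hs.mem_nhds hy)

end HorizontalLift

namespace Foliation

section TransverseCoordinates

variable {m q : ℕ} {M N ι : Type*}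
  [TopologicalSpace M] [ChartedSpace (Coord m) M]
  [TopologicalSpace N] [ChartedSpace (Coord q) N]
  {F : Foliation m q M N ι} {i : ι} {y₀ : N} {x : M}

lemma mdifferentiableAt_f (hx : x ∈ F.U i) : MDifferentiableAt (𝓡 m) (𝓡 q) (F.f i) x :=
  ((F.contMDiffOn_f i).contMDiffAt ((F.isOpen_U i).mem_nhds hx)).mdifferentiableAt (by simp)

lemma isOpen_coordDomain (F : Foliation m q M N ι) (i : ι) (y₀ : N) :
    IsOpen (F.coordDomain i y₀) :=
  (F.contMDiffOn_f i).continuousOn.isOpen_inter_preimage (F.isOpen_U i)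
    (isOpen_extChartAt_source y₀)

lemma coord_mem_target (hx : x ∈ F.coordDomain i y₀) :
    F.coord i y₀ x ∈ (extChartAt (𝓡 q) y₀).target :=
  (extChartAt (𝓡 q) y₀).map_source hx.2

lemma mfderiv_f_eq_mfderiv_γ {i j : ι} (hi : x ∈ F.U i) (hj : x ∈ F.U j)
    (v : TangentSpace (𝓡 m) x) :
    mfderiv (𝓡 m) (𝓡 q) (F.f i) x v
      = mfderiv (𝓡 q) (𝓡 q) (F.γ i j) (F.f j x) (mfderiv (𝓡 m) (𝓡 q) (F.f j) x v) := by
  have hf : F.f i =ᶠ[𝓝 x] F.γ i j ∘ F.f j := by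
    filter_upwards [((F.isOpen_U i).inter (F.isOpen_U j)).mem_nhds ⟨hi, hj⟩] with y hy
    exact F.f_eq i j y hy
  have hγ : MDifferentiableAt (𝓡 q) (𝓡 q) (F.γ i j) (F.f j x) :=
    ((F.contMDiffOn_γ i j).contMDiffAt ((F.γ i j).open_source.mem_nhds
      (F.mem_source i j x ⟨hi, hj⟩))).mdifferentiableAt (by simp)
  rw [hf.mfderiv_eq, mfderiv_comp x hγ (mdifferentiableAt_f hj)]
  rfl

lemma leafTangent_eq_ker (hx : x ∈ F.U i) :
    F.leafTangent x = LinearMap.ker (mfderiv (𝓡 m) (𝓡 q) (F.f i) x).toLinearMap := by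
  refine le_antisymm (F.leafTangent_le hx) (le_iInf₂ fun j hj v hv => ?_)
  exact (mfderiv_f_eq_mfderiv_γ hj hx v).trans ((congrArg _ hv).trans (map_zero _))

variable [IsManifold (𝓡 q) ∞ N]

lemma contMDiffAt_coord (hx : x ∈ F.coordDomain i y₀) :
    ContMDiffAt (𝓡 m) 𝓘(ℝ, Coord q) ∞ (F.coord i y₀) x :=
  ContMDiffAt.comp (I' := 𝓡 q) x (contMDiffAt_extChartAt' (by simpa using hx.2))
    ((F.contMDiffOn_f i).contMDiffAt ((F.isOpen_U i).mem_nhds hx.1))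

lemma mdifferentiableAt_coord (hx : x ∈ F.coordDomain i y₀) :
    MDifferentiableAt (𝓡 m) 𝓘(ℝ, Coord q) (F.coord i y₀) x :=
  (contMDiffAt_coord hx).mdifferentiableAt (by simp)

lemma mfderiv_coord (hx : x ∈ F.coordDomain i y₀) (v : TangentSpace (𝓡 m) x) :
    mfderiv (𝓡 m) 𝓘(ℝ, Coord q) (F.coord i y₀) x v
      = mfderiv (𝓡 q) 𝓘(ℝ, Coord q) (extChartAt (𝓡 q) y₀) (F.f i x)
          (mfderiv (𝓡 m) (𝓡 q) (F.f i) x v) := by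
  have : IsManifold (𝓡 q) 1 N := IsManifold.of_le (n := ∞) (by norm_num)
  exact DFunLike.congr_fun (mfderiv_comp x (mdifferentiableAt_extChartAt (by simpa using hx.2))
    (mdifferentiableAt_f hx.1)) v

lemma surjective_mfderiv_coord (hx : x ∈ F.coordDomain i y₀) :
    Function.Surjective (mfderiv (𝓡 m) 𝓘(ℝ, Coord q) (F.coord i y₀) x) := by
  intro w
  obtain ⟨v, hv⟩ := F.submersion i x hx.1 (mfderiv 𝓘(ℝ, Coord q) (𝓡 q)
    (extChartAt (𝓡 q) y₀).symm (extChartAt (𝓡 q) y₀ (F.f i x)) w)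
  refine ⟨v, ?_⟩
  rw [mfderiv_coord hx, hv]
  exact mfderiv_extChartAt_mfderiv_symm hx.2 w

lemma mem_leafTangent_iff (hx : x ∈ F.coordDomain i y₀) (v : TangentSpace (𝓡 m) x) :
    v ∈ F.leafTangent x ↔ mfderiv (𝓡 m) 𝓘(ℝ, Coord q) (F.coord i y₀) x v = 0 := by
  rw [leafTangent_eq_ker hx.1, mfderiv_coord hx]
  exact (map_eq_zero_iff _ (injective_mfderiv_extChartAt hx.2)).symm

variable [IsManifold (𝓡 m) ∞ M] (g : TangentMetric m M)

lemma horizFrame_spec (hx : x ∈ F.coordDomain i y₀) (a : Fin q) :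
    (∀ u ∈ F.leafTangent x, g.inner x (F.horizFrame g i y₀ a x) u = 0) ∧
      mfderiv (𝓡 m) 𝓘(ℝ, Coord q) (F.coord i y₀) x (F.horizFrame g i y₀ a x)
        = EuclideanSpace.single a (1 : ℝ) := by
  have hsource := mem_extChartAt_source (I := 𝓡 m) x
  have hcoord := mdifferentiableAt_coord hx
  exact Classical.epsilon_spec (p := fun v : TangentSpace (𝓡 m) x =>
    (∀ u ∈ F.leafTangent x, g.inner x v u = 0) ∧
      mfderiv (𝓡 m) 𝓘(ℝ, Coord q) (F.coord i y₀) x v = EuclideanSpace.single a (1 : ℝ))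
    ⟨gradientLift g x (F.coord i y₀) a x,
      fun u hu => inner_gradientLift_eq_zero g hsource hcoord a ((mem_leafTangent_iff hx u).1 hu),
      mfderiv_gradientLift g hsource hcoord (surjective_mfderiv_coord hx) a⟩

lemma coordDeriv_horizFrame (hx : x ∈ F.coordDomain i y₀) (a b : Fin q) :
    F.coordDeriv i y₀ b x (F.horizFrame g i y₀ a x) = if b = a then 1 else 0 := by
  rw [coordDeriv, (horizFrame_spec g hx a).2]
  simp

lemma horizFrame_eq_gradientLift {x₀ : M} (hx : x ∈ F.coordDomain i y₀)
    (hx₀ : x ∈ (extChartAt (𝓡 m) x₀).source) (a : Fin q) :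
    F.horizFrame g i y₀ a x = gradientLift g x₀ (F.coord i y₀) a x := by
  have hcoord := mdifferentiableAt_coord hx
  obtain ⟨orthogonal, projects⟩ := horizFrame_spec g hx a
  have hmem : F.horizFrame g i y₀ a x - gradientLift g x₀ (F.coord i y₀) a x
      ∈ F.leafTangent x := by
    rw [mem_leafTangent_iff hx, map_sub, projects,
      mfderiv_gradientLift g hx₀ hcoord (surjective_mfderiv_coord hx)]
    exact sub_self (EuclideanSpace.single a (1 : ℝ))
  by_contra hne
  have hpos := g.pos x _ (sub_ne_zero.2 hne)
  rw [map_sub (g.inner x), sub_apply, orthogonal _ hmem,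
    inner_gradientLift_eq_zero g hx₀ hcoord a ((mem_leafTangent_iff hx _).1 hmem)] at hpos
  exact hpos.ne' (sub_zero 0)

lemma contMDiffOn_horizFrame (F : Foliation m q M N ι) (i : ι) (y₀ : N) (a : Fin q) :
    ContMDiffOn (𝓡 m) (𝓡 m).tangent ∞
      (fun y => (⟨y, F.horizFrame g i y₀ a y⟩ : TangentBundle (𝓡 m) M))
      (F.coordDomain i y₀) := by
  intro x hx
  have hs : IsOpen (F.coordDomain i y₀ ∩ (extChartAt (𝓡 m) x).source) :=
    (F.isOpen_coordDomain i y₀).inter (isOpen_extChartAt_source x)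
  have hlift := contMDiffOn_gradientLift g hs inter_subset_right (u := F.coord i y₀)
    (fun y hy => (contMDiffAt_coord hy.1).contMDiffWithinAt)
    (fun y hy => surjective_mfderiv_coord hy.1) a
  have hframe := hlift.congr fun y hy =>
    congrArg (TotalSpace.mk y) (horizFrame_eq_gradientLift g hy.1 hy.2 a)
  exact (hframe.contMDiffAt
    (hs.mem_nhds ⟨hx, mem_extChartAt_source x⟩)).contMDiffWithinAt

end TransverseCoordinates

end Foliation

section DirDeriv

variable {m : ℕ} {M : Type*} [TopologicalSpace M] [ChartedSpace (Coord m) M] {u w : M → ℝ} {x : M}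

lemma dirDeriv_mul (hu : MDifferentiableAt (𝓡 m) 𝓘(ℝ, ℝ) u x)
    (hw : MDifferentiableAt (𝓡 m) 𝓘(ℝ, ℝ) w x) (v : TangentSpace (𝓡 m) x) :
    dirDeriv (fun y => u y * w y) x v = dirDeriv u x v * w x + u x * dirDeriv w x v := by
  refine (DFunLike.congr_fun (hu.hasMFDerivAt.mul hw.hasMFDerivAt).mfderiv v).trans ?_
  change u x * dirDeriv w x v + w x * dirDeriv u x v = _
  ring

lemma dirDeriv_congr (h : u =ᶠ[𝓝 x] w) (v : TangentSpace (𝓡 m) x) :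
    dirDeriv u x v = dirDeriv w x v :=
  DFunLike.congr_fun h.mfderiv_eq v

end DirDeriv

namespace Foliation

variable {m q : ℕ} {M N ι : Type*}
  [TopologicalSpace M] [ChartedSpace (Coord m) M]
  [TopologicalSpace N] [ChartedSpace (Coord q) N]
  {F : Foliation m q M N ι} {i : ι} {y₀ : N} {x : M} {p r : ℕ}

lemma NormalTensor.tensor_apply (T : F.NormalTensor p) (U : F.NormalTensor r) (x : M)
    (w : Fin (p + r) → F.Normal x) :
    T.tensor U x w = T x (w ∘ Fin.castAdd r) * U x (w ∘ Fin.natAdd p) := by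
  simp only [tensor, MultilinearMap.domDomCongr_apply, LinearMap.compMultilinearMap_apply,
    MultilinearMap.domCoprod_apply, LinearMap.mul'_apply, finSumFinEquiv_apply_left,
    finSumFinEquiv_apply_right]
  rfl

variable [IsManifold (𝓡 m) ∞ M] {g : TangentMetric m M} {T : F.NormalTensor p}
  {U : F.NormalTensor r}

lemma comp_tensor (T : F.NormalTensor p) (U : F.NormalTensor r) (x : M) :
    (F.comp g i y₀ (T.tensor U) · x) = tensorMul (F.comp g i y₀ T · x) (F.comp g i y₀ U · x) :=
  funext fun _ => NormalTensor.tensor_apply _ _ _ _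

variable [IsManifold (𝓡 q) ∞ N] {g₀ : TangentMetric q N}

lemma contMDiffAt_comp (hT : T.IsSmooth) (g : TangentMetric m M) (hx : x ∈ F.coordDomain i y₀)
    (c : Fin p → Fin q) : ContMDiffAt (𝓡 m) 𝓘(ℝ, ℝ) ∞ (F.comp g i y₀ T c) x :=
  (hT _ (F.isOpen_coordDomain i y₀) (fun j => F.horizFrame g i y₀ (c j))
    fun j => contMDiffOn_horizFrame g F i y₀ (c j)).contMDiffAt
      ((F.isOpen_coordDomain i y₀).mem_nhds hx)

lemma mdifferentiableAt_comp (hT : T.IsSmooth) (g : TangentMetric m M)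
    (hx : x ∈ F.coordDomain i y₀) (c : Fin p → Fin q) :
    MDifferentiableAt (𝓡 m) 𝓘(ℝ, ℝ) (F.comp g i y₀ T c) x :=
  (contMDiffAt_comp hT g hx c).mdifferentiableAt (by simp)

section CovariantDerivative

lemma covDeriv_eq (T : F.NormalTensor p) (c : Fin p → Fin q) (v : TangentSpace (𝓡 m) x) :
    F.covDeriv g g₀ i y₀ T c x v = dirDeriv (F.comp g i y₀ T c) x v
      - ∑ a, F.coordDeriv i y₀ a x v
        * tensorAction (christoffelMatrix g₀ y₀ a (F.coord i y₀ x)) (F.comp g i y₀ T · x) c := by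
  simp only [covDeriv, tensorAction_apply, christoffelMatrix, Matrix.of_apply, Finset.mul_sum,
    mul_assoc]
  rw [Finset.sum_comm]

lemma covDeriv_horizFrame (hx : x ∈ F.coordDomain i y₀) (T : F.NormalTensor p)
    (c : Fin p → Fin q) (b : Fin q) :
    F.covDeriv g g₀ i y₀ T c x (F.horizFrame g i y₀ b x)
      = dirDeriv (F.comp g i y₀ T c) x (F.horizFrame g i y₀ b x)
        - tensorAction (christoffelMatrix g₀ y₀ b (F.coord i y₀ x)) (F.comp g i y₀ T · x) c := by
  simp [covDeriv_eq, coordDeriv_horizFrame g hx]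

lemma dirDeriv_comp_of_isParallel (hpar : F.IsParallel g g₀ T) (hx : x ∈ F.coordDomain i y₀)
    (c : Fin p → Fin q) (v : TangentSpace (𝓡 m) x) :
    dirDeriv (F.comp g i y₀ T c) x v = ∑ a, F.coordDeriv i y₀ a x v
      * tensorAction (christoffelMatrix g₀ y₀ a (F.coord i y₀ x)) (F.comp g i y₀ T · x) c :=
  sub_eq_zero.1 ((covDeriv_eq T c v).symm.trans (hpar i y₀ x hx v c))

lemma mdifferentiableAt_covDeriv_horizFrame (hT : T.IsSmooth) (hx : x ∈ F.coordDomain i y₀)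
    (c : Fin p → Fin q) (b : Fin q) :
    MDifferentiableAt (𝓡 m) 𝓘(ℝ, ℝ)
      (fun y => F.covDeriv g g₀ i y₀ T c y (F.horizFrame g i y₀ b y)) x := by
  have nhds_mem := (F.isOpen_coordDomain i y₀).mem_nhds hx
  have smooth_dirDeriv : ContMDiffAt (𝓡 m) 𝓘(ℝ, ℝ) ∞
      (fun y => dirDeriv (F.comp g i y₀ T c) y (F.horizFrame g i y₀ b y)) x :=
    (contMDiffOn_mfderiv_apply (F.isOpen_coordDomain i y₀)
      (fun y hy => (contMDiffAt_comp hT g hy c).contMDiffWithinAt)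
      (contMDiffOn_horizFrame g F i y₀ b)).contMDiffAt nhds_mem
  have smooth_action : ContMDiffAt (𝓡 m) 𝓘(ℝ, ℝ) ∞ (fun y => tensorAction
      (christoffelMatrix g₀ y₀ b (F.coord i y₀ y)) (F.comp g i y₀ T · y) c) x := by
    simp only [tensorAction_apply, christoffelMatrix, Matrix.of_apply]
    exact ContMDiffAt.sum fun j _ => ContMDiffAt.sum fun d _ =>
      ((contDiffAt_christoffel g₀ y₀ (coord_mem_target hx) b (c j) d).contMDiffAt.comp x
        (contMDiffAt_coord hx)).mul (contMDiffAt_comp hT g hx _)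
  refine ((smooth_dirDeriv.sub smooth_action).mdifferentiableAt
    (by simp)).congr_of_eventuallyEq ?_
  filter_upwards [nhds_mem] with y hy using covDeriv_horizFrame hy T c b

lemma covDeriv_tensor (hT : T.IsSmooth) (hU : U.IsSmooth) (hx : x ∈ F.coordDomain i y₀)
    (v : TangentSpace (𝓡 m) x) :
    (F.covDeriv g g₀ i y₀ (T.tensor U) · x v)
      = tensorMul (F.covDeriv g g₀ i y₀ T · x v) (F.comp g i y₀ U · x)
        + tensorMul (F.comp g i y₀ T · x) (F.covDeriv g g₀ i y₀ U · x v) := by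
  funext c
  have comp_eq : F.comp g i y₀ (T.tensor U) c = fun y =>
      F.comp g i y₀ T (c ∘ Fin.castAdd r) y * F.comp g i y₀ U (c ∘ Fin.natAdd p) y :=
    funext fun y => congrFun (comp_tensor T U y) c
  simp only [covDeriv_eq, comp_tensor, tensorAction_tensorMul]
  rw [comp_eq, dirDeriv_mul (mdifferentiableAt_comp hT g hx _) (mdifferentiableAt_comp hU g hx _)]
  simp only [tensorMul, Pi.add_apply, sub_mul, mul_sub, mul_add, Finset.sum_add_distrib,
    Finset.sum_mul, Finset.mul_sum, mul_assoc, mul_left_comm (F.comp g i y₀ T _ x)]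
  ring

lemma covDeriv_tensor_of_isParallel (hT : T.IsSmooth) (hpar : F.IsParallel g g₀ T)
    (hU : U.IsSmooth) (hx : x ∈ F.coordDomain i y₀) (v : TangentSpace (𝓡 m) x) :
    (F.covDeriv g g₀ i y₀ (T.tensor U) · x v)
      = tensorMul (F.comp g i y₀ T · x) (F.covDeriv g g₀ i y₀ U · x v) := by
  rw [covDeriv_tensor hT hU hx]
  funext c
  simp [tensorMul, hpar i y₀ x hx v]

lemma covDeriv₂_tensor_of_isParallel (hT : T.IsSmooth) (hpar : F.IsParallel g g₀ T)
    (hU : U.IsSmooth) (hx : x ∈ F.coordDomain i y₀) (a b : Fin q) :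
    (F.covDeriv₂ g g₀ i y₀ (T.tensor U) a b · x)
      = tensorMul (F.comp g i y₀ T · x) (F.covDeriv₂ g g₀ i y₀ U a b · x) := by
  have covDeriv₂_eq : ∀ {s : ℕ} (V : F.NormalTensor s) (c : Fin s → Fin q),
      F.covDeriv₂ g g₀ i y₀ V a b c x
        = dirDeriv (fun z => F.covDeriv g g₀ i y₀ V c z (F.horizFrame g i y₀ b z)) x
            (F.horizFrame g i y₀ a x)
          - tensorAction (christoffelMatrix g₀ y₀ a (F.coord i y₀ x))
              (F.covDeriv g g₀ i y₀ V · x (F.horizFrame g i y₀ b x)) c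
          - ∑ d, christoffel g₀ y₀ a b d (F.coord i y₀ x)
              * F.covDeriv g g₀ i y₀ V c x (F.horizFrame g i y₀ d x) :=
    fun _ _ => rfl
  have covDeriv_tensor_eq := fun z hz v =>
    covDeriv_tensor_of_isParallel (x := z) (i := i) (y₀ := y₀) hT hpar hU hz v
  funext c
  have covDeriv_near : (fun z =>
      F.covDeriv g g₀ i y₀ (T.tensor U) c z (F.horizFrame g i y₀ b z)) =ᶠ[𝓝 x]
      fun z => F.comp g i y₀ T (c ∘ Fin.castAdd r) z
        * F.covDeriv g g₀ i y₀ U (c ∘ Fin.natAdd p) z (F.horizFrame g i y₀ b z) := by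
    filter_upwards [(F.isOpen_coordDomain i y₀).mem_nhds hx] with z hz
    exact congrFun (covDeriv_tensor_eq z hz _) c
  have covDeriv_at := fun d => congrFun (covDeriv_tensor_eq x hx (F.horizFrame g i y₀ d x)) c
  rw [covDeriv₂_eq, dirDeriv_congr covDeriv_near, dirDeriv_mul (mdifferentiableAt_comp hT g hx _)
    (mdifferentiableAt_covDeriv_horizFrame hU hx _ _), dirDeriv_comp_of_isParallel hpar hx,
    covDeriv_tensor_eq x hx, tensorAction_tensorMul]
  simp only [covDeriv_at, coordDeriv_horizFrame g hx, ite_mul, one_mul, zero_mul,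
    Finset.sum_ite_eq', Finset.mem_univ, if_true, tensorMul, covDeriv₂_eq, Pi.add_apply,
    mul_sub, Finset.mul_sum, mul_left_comm (F.comp g i y₀ T _ x)]
  ring

end CovariantDerivative

section Curvature

lemma fderiv_comp_extChartAt_symm_of_isParallel {x₀ : M} (hT : T.IsSmooth)
    (hpar : F.IsParallel g g₀ T) (hx : x ∈ F.coordDomain i y₀)
    (hx₀ : x ∈ (extChartAt (𝓡 m) x₀).source) (v : Coord m) :
    fderiv ℝ (fun z c => F.comp g i y₀ T c ((extChartAt (𝓡 m) x₀).symm z))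
        (extChartAt (𝓡 m) x₀ x) v
      = ∑ a, fderiv ℝ (F.coord i y₀ ∘ (extChartAt (𝓡 m) x₀).symm) (extChartAt (𝓡 m) x₀ x) v a
        • tensorAction (christoffelMatrix g₀ y₀ a (F.coord i y₀ x)) (F.comp g i y₀ T · x) := by
  have differentiable_comp : ∀ c, DifferentiableAt ℝ
      (fun z => F.comp g i y₀ T c ((extChartAt (𝓡 m) x₀).symm z)) (extChartAt (𝓡 m) x₀ x) :=
    fun c => (contDiffAt_comp_extChartAt_symm hx₀
      (contMDiffAt_comp hT g hx c)).differentiableAt (by simp)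
  funext c
  rw [fderiv_pi differentiable_comp, ContinuousLinearMap.pi_apply,
    fderiv_comp_extChartAt_symm hx₀ (mdifferentiableAt_coord hx), Finset.sum_apply]
  exact (fderiv_comp_extChartAt_symm hx₀ (mdifferentiableAt_comp hT g hx c) v).trans
    (dirDeriv_comp_of_isParallel hpar hx c _)

lemma tensorAction_connectionCurvature_comp_eq_zero (hT : T.IsSmooth)
    (hpar : F.IsParallel g g₀ T) (hx : x ∈ F.coordDomain i y₀) (a b : Fin q) :
    tensorAction (connectionCurvature (christoffelMatrix g₀ y₀) a b (F.coord i y₀ x))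
      (F.comp g i y₀ T · x) = 0 := by
  have hsource := mem_extChartAt_source (I := 𝓡 m) x
  have hinv := (extChartAt (𝓡 m) x).left_inv hsource
  have domain_mem : (extChartAt (𝓡 m) x).symm ⁻¹' F.coordDomain i y₀
      ∈ 𝓝 (extChartAt (𝓡 m) x x) :=
    (continuousAt_extChartAt_symm x).preimage_mem_nhds
      ((F.isOpen_coordDomain i y₀).mem_nhds (by rwa [hinv]))
  have h := tensorAction_connectionCurvature_eq_zero (Γ := christoffelMatrix g₀ y₀)
    (u := F.coord i y₀ ∘ (extChartAt (𝓡 m) x).symm)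
    (t := fun z c => F.comp g i y₀ T c ((extChartAt (𝓡 m) x).symm z)) (z := extChartAt (𝓡 m) x x)
    (fun a b d => by
      rw [Function.comp_apply, hinv]
      exact (contDiffAt_christoffel g₀ y₀ (coord_mem_target hx) a b d).differentiableAt (by simp))
    ((contDiffAt_comp_extChartAt_symm hsource (contMDiffAt_coord hx)).of_le (by norm_cast))
    (contDiffAt_pi.2 fun c => (contDiffAt_comp_extChartAt_symm hsource
      (contMDiffAt_comp hT g hx c)).of_le (by norm_cast))
    (surjective_fderiv_comp_extChartAt_symm hsource (mdifferentiableAt_coord hx)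
      (surjective_mfderiv_coord hx)) ?_ a b
  · simpa only [Function.comp_apply, hinv] using h
  · filter_upwards [domain_mem, extChartAt_target_mem_nhds (I := 𝓡 m) x] with z hz htarget v
    obtain ⟨y, hy, rfl⟩ := (extChartAt (𝓡 m) x).surjOn htarget
    rw [mem_preimage, (extChartAt (𝓡 m) x).left_inv hy] at hz
    simpa only [Function.comp_apply, (extChartAt (𝓡 m) x).left_inv hy] using
      fderiv_comp_extChartAt_symm_of_isParallel hT hpar hz hy v

lemma tensorAction_raisedRiemann_comp_eq_zero (hT : T.IsSmooth) (hpar : F.IsParallel g g₀ T)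
    (hx : x ∈ F.coordDomain i y₀) (a b : Fin q) :
    tensorAction (raisedRiemann g₀ y₀ (F.coord i y₀ x) a b) (F.comp g i y₀ T · x) = 0 := by
  simp [raisedRiemann_eq_sum_connectionCurvature g₀ y₀ (coord_mem_target hx),
    LinearMap.sum_apply, tensorAction_connectionCurvature_comp_eq_zero hT hpar hx]

end Curvature

section Laplacian

lemma laplacianComp_eq (hx : x ∈ F.coordDomain i y₀) (T : F.NormalTensor p)
    (c : Fin p → Fin q) :
    F.laplacianComp g g₀ i y₀ T c x
      = -∑ a, ∑ b, metricInv g₀ y₀ (F.coord i y₀ x) a b * F.covDeriv₂ g g₀ i y₀ T a b c x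
        - casimirAction (raisedRiemann g₀ y₀ (F.coord i y₀ x)) (F.comp g i y₀ T · x) c := by
  have ricci_term : ∑ j, ∑ A, ∑ A', ricci g₀ y₀ (c j) A (F.coord i y₀ x)
        * metricInv g₀ y₀ (F.coord i y₀ x) A A' * F.comp g i y₀ T (Function.update c j A') x
      = -tensorAction (Matrix.of fun a d => ∑ b, raisedRiemann g₀ y₀ (F.coord i y₀ x) a b b d)
          (F.comp g i y₀ T · x) c := by
    simp only [sum_raisedRiemann_eq_neg_ricci g₀ y₀ (coord_mem_target hx), tensorAction_apply,
      Matrix.of_apply, neg_mul, Finset.sum_neg_distrib, neg_neg, Finset.sum_mul]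
    exact Finset.sum_congr rfl fun j _ => Finset.sum_comm
  have riemann_term : ∑ j, ∑ k ∈ Finset.univ.erase j, ∑ A, ∑ A', ∑ B, ∑ B',
        riemann g₀ y₀ (c j) A (c k) B (F.coord i y₀ x)
        * metricInv g₀ y₀ (F.coord i y₀ x) A A' * metricInv g₀ y₀ (F.coord i y₀ x) B B'
        * F.comp g i y₀ T (Function.update (Function.update c j A') k B') x
      = pairAction (raisedRiemann g₀ y₀ (F.coord i y₀ x)) (F.comp g i y₀ T · x) c := by
    simp only [pairAction, raisedRiemann, Matrix.of_apply, Finset.sum_mul]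
    refine Finset.sum_congr rfl fun j _ => Finset.sum_congr rfl fun k _ => ?_
    rw [Finset.sum_comm]
    exact Finset.sum_congr rfl fun A' _ =>
      (Finset.sum_congr rfl fun A _ => Finset.sum_comm).trans Finset.sum_comm
  rw [laplacianComp, ricci_term, riemann_term, casimirAction_eq_add_pairAction, Pi.add_apply]
  ring

lemma laplacianComp_tensor_of_isParallel (hT : T.IsSmooth) (hpar : F.IsParallel g g₀ T)
    (hU : U.IsSmooth) (hx : x ∈ F.coordDomain i y₀) :
    (F.laplacianComp g g₀ i y₀ (T.tensor U) · x)
      = tensorMul (F.comp g i y₀ T · x) (F.laplacianComp g g₀ i y₀ U · x) := by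
  funext c
  have covDeriv₂_tensor := fun a b =>
    congrFun (covDeriv₂_tensor_of_isParallel (g₀ := g₀) hT hpar hU hx a b) c
  rw [laplacianComp_eq hx, comp_tensor, casimirAction_tensorMul
    (raisedRiemann_pair_symm g₀ y₀ (coord_mem_target hx))
    (tensorAction_raisedRiemann_comp_eq_zero hT hpar hx)]
  simp only [covDeriv₂_tensor, tensorMul, laplacianComp_eq hx, mul_sub, mul_neg, Finset.mul_sum,
    mul_left_comm (F.comp g i y₀ T _ x)]

lemma sum_normalCoord_smul_horizFrame (g : TangentMetric m M) (hx : x ∈ F.coordDomain i y₀)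
    (w : F.Normal x) :
    ∑ a, F.normalCoord y₀ hx.1 a w • (F.leafTangent x).mkQ (F.horizFrame g i y₀ a x) = w := by
  obtain ⟨v, rfl⟩ := (F.leafTangent x).mkQ_surjective w
  have normalCoord_mkQ : ∀ a, F.normalCoord y₀ hx.1 a ((F.leafTangent x).mkQ v)
      = F.coordDeriv i y₀ a x v := by
    intro a
    rw [coordDeriv, mfderiv_coord hx]
    rfl
  simp only [normalCoord_mkQ, ← map_smul, ← map_sum]
  rw [Submodule.mkQ_apply, Submodule.mkQ_apply, Submodule.Quotient.eq, mem_leafTangent_iff hx,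
    map_sub, map_sum]
  simp only [map_smul, (horizFrame_spec g hx _).2]
  exact sub_eq_zero.2 (sum_smul_single _)

lemma sum_comp_mul_prod_normalCoord (T : F.NormalTensor p) (g : TangentMetric m M)
    (hx : x ∈ F.coordDomain i y₀) (w : Fin p → F.Normal x) :
    ∑ c : Fin p → Fin q, F.comp g i y₀ T c x * ∏ j, F.normalCoord y₀ hx.1 (c j) (w j)
      = T x w := by
  conv_rhs => rw [← funext fun j => sum_normalCoord_smul_horizFrame g hx (w j),
    MultilinearMap.map_sum]
  refine Finset.sum_congr rfl fun c _ => ?_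
  rw [MultilinearMap.map_smul_univ, smul_eq_mul, mul_comm]
  rfl

lemma laplacianIn_apply (T : F.NormalTensor p) (hx : x ∈ F.U i) (w : Fin p → F.Normal x) :
    F.laplacianIn g g₀ y₀ T hx w = ∑ c : Fin p → Fin q, F.laplacianComp g g₀ i y₀ T c x
      * ∏ j, F.normalCoord y₀ hx (c j) (w j) := by
  simp [laplacianIn]

lemma laplacianIn_tensor_of_isParallel (hT : T.IsSmooth) (hpar : F.IsParallel g g₀ T)
    (hU : U.IsSmooth) (hx : x ∈ F.coordDomain i y₀) (w : Fin (p + r) → F.Normal x) :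
    F.laplacianIn g g₀ y₀ (T.tensor U) hx.1 w
      = T x (w ∘ Fin.castAdd r) * F.laplacianIn g g₀ y₀ U hx.1 (w ∘ Fin.natAdd p) := by
  rw [laplacianIn_apply, laplacianIn_apply, ← sum_comp_mul_prod_normalCoord T g hx,
    Finset.sum_mul_sum, ← Fintype.sum_prod_type', ← (Fin.appendEquiv p r).symm.sum_comp]
  refine Finset.sum_congr rfl fun c _ => ?_
  rw [show F.laplacianComp g g₀ i y₀ (T.tensor U) c x = _ from
    congrFun (laplacianComp_tensor_of_isParallel hT hpar hU hx) c, Fin.prod_univ_add]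
  exact mul_mul_mul_comm _ _ _ _

end Laplacian

end Foliation

end

theorem mainTheorem7_general {m q : ℕ} {M N ι : Type*}
    [TopologicalSpace M] [ChartedSpace (Coord m) M] [IsManifold (𝓡 m) ∞ M]
    [TopologicalSpace N] [ChartedSpace (Coord q) N] [IsManifold (𝓡 q) ∞ N]
    (g : TangentMetric m M) (g₀ : TangentMetric q N)
    (F : Foliation m q M N ι)
    {p : ℕ} (T : F.NormalTensor p) (hT : T.IsSmooth) (hpar : F.IsParallel g g₀ T)
    {r : ℕ} (U : F.NormalTensor r) (hU : U.IsSmooth) :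
    F.basicLaplacian g g₀ (T.tensor U) = T.tensor (F.basicLaplacian g g₀ U) := by
  funext x
  ext w
  rw [Foliation.NormalTensor.tensor_apply]
  exact Foliation.laplacianIn_tensor_of_isParallel hT hpar hU
    ⟨(F.exists_mem x).choose_spec, mem_extChartAt_source _⟩ w

theorem mainTheorem7 {m q : ℕ} {M N ι : Type*}
    [TopologicalSpace M] [ChartedSpace (Coord m) M] [IsManifold (𝓡 m) ∞ M]
    [TopologicalSpace N] [ChartedSpace (Coord q) N] [IsManifold (𝓡 q) ∞ N]
    (g : TangentMetric m M) (g₀ : TangentMetric q N)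
    (F : Foliation m q M N ι) (hF : F.IsRiemannian g g₀)
    {p : ℕ} (T : F.NormalTensor p) (hT : T.IsSmooth) (hpar : F.IsParallel g g₀ T)
    {r : ℕ} (U : F.NormalTensor r) (hU : U.IsSmooth) :
    F.basicLaplacian g g₀ (T.tensor U) = T.tensor (F.basicLaplacian g g₀ U) := by
  exact mainTheorem7_general g g₀ F T hT hpar U hU
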